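/- Let $1<m<2$, $\kappa\in\mathbb{R}$, and put $G_m(x)=\kappa|x|^{m-2}$ for $x\in\mathbb{R}^2\setminus\{0\}$ (for a suitable $\kappa=\kappa(m)$ this is the Green function of $(-\Delta)^{m/2}$ on $\mathbb{R}^2$) and $k_m=\nabla^\perp G_m=(-\partial_{x_2}G_m,\partial_{x_1}G_m)$. Let $\rho\in C^\infty_c(\mathbb{R}^2)$ satisfy $\rho(-x)=\rho(x)$, $0\le\rho\le1$ and $\int\rho\,dx=1$; for $\epsilon>0$ let $\rho_\epsilon(x)=\epsilon^{-2}\rho(x/\epsilon)$ and $k_m^\epsilon=\rho_\epsilon\star k_m$. Given a finite signed measure $\theta_0$ on $\mathbb{R}^2$, a solution on $[0,\infty)$, in the sense of distributions, of $$\partial_t\theta+\operatorname{div}(u\theta)=0,\qquad u=k_m^\epsilon\star\theta,\qquad \theta(0)=\theta_0,$$ is a family $(\theta(t))_{t\ge0}$ of finite signed measures on $\mathbb{R}^2$, with total variation bounded on bounded time intervals, such that for all $\varphi\in C^\infty_c(\mathbb{R}^2)$ and $t\ge0$ the function $s\mapsto\int u(s,x)\cdot\nabla\varphi(x)\,\theta(s,dx)$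 is integrable on $[0,t]$ and $$\int\varphi\,d\theta(t)-\int\varphi\,d\theta_0=\int_0^t\int u(s,x)\cdot\nabla\varphi(x)\,\theta(s,dx)\,ds .$$ For finite non-negative measures $\mu,\nu$ of equal mass let $W_1(\mu,\nu)$ be the infimum of $\int \min(1,|x-y|)\,\pi(dx,dy)$ over all couplings $\pi$ of $\mu$ and $\nu$, and for finite signed measures with equal positive masses and equal negative masses let $W_1(\mu,\nu)=W_1(\mu_+,\nu_+)+W_1(\mu_-,\nu_-)$. Then the following hold. (i) For every finite signed measure $\theta_0$ and every $\epsilon>0$ there is exactly one solution $\theta$ on $[0,\infty)$. (ii) The number $c_\epsilon=\max\bigl(2\|k_m^\epsilon\|_{L^\infty},\|\nabla k_m^\epsilon\|_{L^\infty}\bigr)$ is finite. If $\theta_0^1,\theta_0^2$ are finite signed measures with the same positive mass and the same negative mass, and with total variation at most $M$, and $\theta_1,\theta_2$ are the solutions with these initial conditions, then for all $T>0$ $$\sup_{t\in[0,T]}W_1(\theta_1(t),\theta_2(t))\le C(c_\epsilon,T,M)\,W_1(\theta_0^1,\theta_0^2),$$ where $C(c_\epsilon,T,M)$ depends only on $c_\epsilon$,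 $T$ and $M$. (iii) If $\theta_0$ has a density in $L^1(\mathbb{R}^2)\cap L^\infty(\mathbb{R}^2)$, then so does $\theta(t)$ for every $t\ge0$, and $\|\theta(t)\|_{L^p}\le\|\theta_0\|_{L^p}$ for every $p\in(0,\infty]$ (in particular for $1\le p\le\infty$; for $p<1$ the two sides may be infinite). -/

import Mathlib

open MeasureTheory
open scoped NNReal ENNReal

noncomputable section

namespace GSQG

/-- The plane with its Euclidean norm. -/
abbrev Plane : Type := EuclideanSpace ℝ (Fin 2)

/-- The perpendicular gradient `(-∂₂ f, ∂₁ f)`. -/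
def perpGrad (f : Plane → ℝ) (x : Plane) : Plane :=
  !₂[-(fderiv ℝ f x (EuclideanSpace.single 1 1)), fderiv ℝ f x (EuclideanSpace.single 0 1)]

/-- The Green function of the fractional Laplacian of order `m`, up to the normalization, which is
the free parameter `κ`. -/
def green (m κ : ℝ) (x : Plane) : ℝ := κ * ‖x‖ ^ (m - 2)

/-- The kernel `k_m`, the perpendicular gradient of the Green function. -/
def kernel (m κ : ℝ) : Plane → Plane := perpGrad (green m κ)

/-- The functions `ρ` that generate the regularization. -/
structure IsMollifier (ρ : Plane → ℝ) : Prop where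
  smooth : ContDiff ℝ ((⊤ : ℕ∞) : WithTop ℕ∞) ρ
  compactSupport : HasCompactSupport ρ
  symmetric : ∀ x, ρ (-x) = ρ x
  nonneg : ∀ x, 0 ≤ ρ x
  le_one : ∀ x, ρ x ≤ 1
  integral_eq_one : ∫ x, ρ x = 1

/-- `ρ_ε (x) = ε⁻² ρ (x / ε)`. -/
def rescale (ρ : Plane → ℝ) (ε : ℝ) (x : Plane) : ℝ := (ε ^ 2)⁻¹ * ρ (ε⁻¹ • x)

/-- The regularized kernel `ρ_ε ⋆ k_m`. -/
def regKernel (m κ : ℝ) (ρ : Plane → ℝ) (ε : ℝ) : Plane → Plane :=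
  convolution (rescale ρ ε) (kernel m κ) (ContinuousLinearMap.lsmul ℝ ℝ) volume

/-- The number `max (2 ‖k‖_∞) ‖∇k‖_∞`, with the operator norm on the derivative. -/
def kernelConst (k : Plane → Plane) : ℝ≥0∞ :=
  max (2 * eLpNorm k ⊤ volume) (eLpNorm (fderiv ℝ k) ⊤ volume)

/-- The integral of a function against a finite signed measure. -/
def sintegral {F : Type*} [NormedAddCommGroup F] [NormedSpace ℝ F]
    (μ : SignedMeasure Plane) (f : Plane → F) : F :=
  (∫ x, f x ∂μ.toJordanDecomposition.posPart) - ∫ x, f x ∂μ.toJordanDecomposition.negPart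

/-- The velocity field `k ⋆ μ`. -/
def velocity (k : Plane → Plane) (μ : SignedMeasure Plane) (x : Plane) : Plane :=
  sintegral μ fun y => k (x - y)

/-- `θ` is a solution on `[0, ∞)`, in the sense of distributions, of
`∂_t θ + div (u θ) = 0`, `u = k ⋆ θ`, `θ(0) = θ₀`: a family of finite signed measures, of total
variation bounded on bounded time intervals, that satisfies the equation integrated in time against
every test function. Values at negative times are irrelevant. -/
structure IsSolution (k : Plane → Plane) (θ₀ : SignedMeasure Plane)
    (θ : ℝ → SignedMeasure Plane) : Prop where
  locally_bounded : ∀ T : ℝ, ∃ M : ℝ≥0, ∀ t ∈ Set.Icc 0 T, (θ t).totalVariation Set.univ ≤ M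
  integrable : ∀ φ : Plane → ℝ, ContDiff ℝ ((⊤ : ℕ∞) : WithTop ℕ∞) φ → HasCompactSupport φ →
    ∀ t : ℝ, 0 ≤ t → IntervalIntegrable
      (fun s => sintegral (θ s) fun x => fderiv ℝ φ x (velocity k (θ s) x)) volume 0 t
  weak_eq : ∀ φ : Plane → ℝ, ContDiff ℝ ((⊤ : ℕ∞) : WithTop ℕ∞) φ → HasCompactSupport φ →
    ∀ t : ℝ, 0 ≤ t → sintegral (θ t) φ - sintegral θ₀ φ
      = ∫ s in (0 : ℝ)..t, sintegral (θ s) fun x => fderiv ℝ φ x (velocity k (θ s) x)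

/-- The `1`-Wasserstein distance of two measures for the bounded metric `min 1 |x - y|`; it is
infinite if there is no coupling, that is, if the masses differ. -/
def wass (μ ν : Measure Plane) : ℝ≥0∞ :=
  ⨅ (π : Measure (Plane × Plane)) (_ : π.map Prod.fst = μ ∧ π.map Prod.snd = ν),
    ∫⁻ z, ENNReal.ofReal (min 1 ‖z.1 - z.2‖) ∂π

/-- The extension of the Wasserstein distance to signed measures. -/
def signedWass (μ ν : SignedMeasure Plane) : ℝ≥0∞ :=
  wass μ.toJordanDecomposition.posPart ν.toJordanDecomposition.posPart
    + wass μ.toJordanDecomposition.negPart ν.toJordanDecomposition.negPart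

end GSQG

end

/-!
A solution is the image of `θ₀` under the flow of its own velocity field: moving a test function
along an Euler step of that flow changes its integral against `θ(t)` and against the transported
measure by the same amount up to `O(h²)`, so these integrals agree. The flow itself solves an
ordinary differential equation for the displacement of all particles, in the space of bounded
continuous maps, whose vector field is Lipschitz because the kernel is. Two solutions are compared
along their flows, with the particles paired by a coupling of the initial measures: the mean
distance of the pairs satisfies a Grönwall inequality with rate `2 c M`. Finally `k` is
divergence free, being a limit of mollified perpendicular gradients, so the flow preserves the
Lebesgue measure and a density is only rearranged.
-/

noncomputable section

namespace GSQG

open Filter Topology Set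
open scoped ContDiff BoundedContinuousFunction

section SignedMeasure

theorem measure_ext_of_integral_contDiff {E : Type*} [NormedAddCommGroup E] [NormedSpace ℝ E]
    [FiniteDimensional ℝ E] [MeasurableSpace E] [BorelSpace E] {μ ν : Measure E}
    [IsFiniteMeasureOnCompacts μ] [IsFiniteMeasureOnCompacts ν]
    (h : ∀ φ : E → ℝ, ContDiff ℝ ∞ φ → HasCompactSupport φ → ∫ x, φ x ∂μ = ∫ x, φ x ∂ν) :
    μ = ν := by
  have hμ : μ ≪ μ + ν := Measure.absolutelyContinuous_of_le (Measure.le_add_right le_rfl)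
  have hν : ν ≪ μ + ν := Measure.absolutelyContinuous_of_le (Measure.le_add_left le_rfl)
  have hloc (ξ : Measure E) [IsFiniteMeasureOnCompacts ξ] :
      LocallyIntegrable (fun x => (ξ.rnDeriv (μ + ν) x).toReal) (μ + ν) :=
    locallyIntegrable_iff.2 fun _ hk => Measure.integrableOn_toReal_rnDeriv hk.measure_lt_top.ne
  have hdensity : μ.rnDeriv (μ + ν) =ᵐ[μ + ν] ν.rnDeriv (μ + ν) := by
    filter_upwards [ae_eq_of_integral_contDiff_smul_eq (hloc μ) (hloc ν) fun φ hφ hc => by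
        simp only [smul_eq_mul, mul_comm (φ _)]
        simpa only [← smul_eq_mul, integral_rnDeriv_smul hμ, integral_rnDeriv_smul hν]
          using h φ hφ hc,
      μ.rnDeriv_ne_top (μ + ν), ν.rnDeriv_ne_top (μ + ν)] with x hx hμx hνx
    exact (ENNReal.toReal_eq_toReal_iff' hμx hνx).1 hx
  rw [← Measure.withDensity_rnDeriv_eq μ _ hμ, withDensity_congr_ae hdensity,
    Measure.withDensity_rnDeriv_eq ν _ hν]

variable {F : Type*} [NormedAddCommGroup F]

theorem integrable_totalVariation_iff {α : Type*} [MeasurableSpace α] {μ : SignedMeasure α}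
    {f : α → F} : Integrable f μ.totalVariation ↔
      Integrable f μ.toJordanDecomposition.posPart ∧
        Integrable f μ.toJordanDecomposition.negPart :=
  integrable_add_measure

theorem integrable_of_continuous_of_norm_le {α : Type*} [TopologicalSpace α] [MeasurableSpace α]
    [OpensMeasurableSpace α] [SecondCountableTopology α] {μ : Measure α} [IsFiniteMeasure μ]
    {f : α → F} (hf : Continuous f) {C : ℝ} (hC : ∀ x, ‖f x‖ ≤ C) : Integrable f μ :=
  Integrable.of_bound hf.aestronglyMeasurable C (Eventually.of_forall hC)

variable [NormedSpace ℝ F]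

theorem sintegral_sub {μ : SignedMeasure Plane} {f g : Plane → F}
    (hf : Integrable f μ.totalVariation) (hg : Integrable g μ.totalVariation) :
    sintegral μ (fun x => f x - g x) = sintegral μ f - sintegral μ g := by
  rw [integrable_totalVariation_iff] at hf hg
  simp only [sintegral, integral_sub hf.1 hg.1, integral_sub hf.2 hg.2]
  abel

theorem sintegral_smul (μ : SignedMeasure Plane) (c : ℝ) (f : Plane → F) :
    sintegral μ (fun x => c • f x) = c • sintegral μ f := by
  simp only [sintegral, integral_smul, smul_sub]

theorem norm_sintegral_le {μ : SignedMeasure Plane} {f : Plane → F} {C M : ℝ}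
    (hC : ∀ x, ‖f x‖ ≤ C) (hM : μ.totalVariation.real univ ≤ M) :
    ‖sintegral μ f‖ ≤ C * M := by
  have hC0 : 0 ≤ C := (norm_nonneg _).trans (hC 0)
  calc ‖sintegral μ f‖
      ≤ C * μ.toJordanDecomposition.posPart.real univ
        + C * μ.toJordanDecomposition.negPart.real univ :=
        (norm_sub_le _ _).trans (add_le_add
          (norm_integral_le_of_norm_le_const (Eventually.of_forall hC))
          (norm_integral_le_of_norm_le_const (Eventually.of_forall hC)))
    _ = C * μ.totalVariation.real univ := by
        rw [SignedMeasure.totalVariation, measureReal_add_apply, mul_add]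
    _ ≤ C * M := mul_le_mul_of_nonneg_left hM hC0

theorem norm_sintegral_sub_le {μ : SignedMeasure Plane} {f g : Plane → F} {C M : ℝ}
    (hf : Integrable f μ.totalVariation) (hg : Integrable g μ.totalVariation)
    (hC : ∀ x, ‖f x - g x‖ ≤ C) (hM : μ.totalVariation.real univ ≤ M) :
    ‖sintegral μ f - sintegral μ g‖ ≤ C * M := by
  rw [← sintegral_sub hf hg]
  exact norm_sintegral_le hC hM

theorem tendsto_sintegral_of_norm_le (μ : SignedMeasure Plane) {f : ℕ → Plane → F}
    {g : Plane → F} (hf : ∀ n, Continuous (f n)) {C : ℝ} (hC : ∀ n x, ‖f n x‖ ≤ C)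
    (hlim : ∀ x, Tendsto (fun n => f n x) atTop (𝓝 (g x))) :
    Tendsto (fun n => sintegral μ (f n)) atTop (𝓝 (sintegral μ g)) := by
  have tendsto_integral (ν : Measure Plane) [IsFiniteMeasure ν] :
      Tendsto (fun n => ∫ x, f n x ∂ν) atTop (𝓝 (∫ x, g x ∂ν)) :=
    tendsto_integral_of_dominated_convergence (fun _ => C)
      (fun n => (hf n).aestronglyMeasurable)
      (integrable_const C)
      (fun n => Eventually.of_forall (hC n)) (Eventually.of_forall hlim)
  exact (tendsto_integral _).sub (tendsto_integral _)

theorem signedMeasure_ext_of_sintegral_contDiff {μ ν : SignedMeasure Plane}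
    (h : ∀ φ : Plane → ℝ, ContDiff ℝ ∞ φ → HasCompactSupport φ →
      sintegral μ φ = sintegral ν φ) : μ = ν := by
  have hsum : μ.toJordanDecomposition.posPart + ν.toJordanDecomposition.negPart
      = ν.toJordanDecomposition.posPart + μ.toJordanDecomposition.negPart := by
    refine measure_ext_of_integral_contDiff fun φ hφ hc => ?_
    have hint (ξ : Measure Plane) [IsFiniteMeasure ξ] : Integrable φ ξ :=
      hφ.continuous.integrable_of_hasCompactSupport hc
    have hφμν := h φ hφ hc
    rw [sintegral, sintegral] at hφμν
    rw [integral_add_measure (hint _) (hint _), integral_add_measure (hint _) (hint _)]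
    linarith
  ext s hs
  have hs_sum := congrArg (Measure.real · s) hsum
  rw [measureReal_add_apply, measureReal_add_apply] at hs_sum
  rw [SignedMeasure.apply_eq_posPart_real_sub_negPart_real _ hs,
    SignedMeasure.apply_eq_posPart_real_sub_negPart_real _ hs]
  linarith

section Push

variable {α β : Type*} [MeasurableSpace α] [MeasurableSpace β] {Φ : α → β}

/-- The image of a signed measure under a map. It has its expected meaning for measurable maps
only: otherwise it is `0`. -/
def push (Φ : α → β) (μ : SignedMeasure α) : SignedMeasure β := VectorMeasure.map μ Φ

theorem toJordanDecomposition_push (hΦ : MeasurableEmbedding Φ) (μ : SignedMeasure α) :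
    (push Φ μ).toJordanDecomposition.posPart = μ.toJordanDecomposition.posPart.map Φ ∧
      (push Φ μ).toJordanDecomposition.negPart = μ.toJordanDecomposition.negPart.map Φ := by
  let j : JordanDecomposition β :=
    { posPart := μ.toJordanDecomposition.posPart.map Φ
      negPart := μ.toJordanDecomposition.negPart.map Φ
      posPart_finite := inferInstance
      negPart_finite := inferInstance
      mutuallySingular := hΦ.mutuallySingular_map μ.toJordanDecomposition.mutuallySingular }
  suffices hj : (push Φ μ).toJordanDecomposition = j by
    rw [hj]
    exact ⟨rfl, rfl⟩
  refine SignedMeasure.toJordanDecomposition_eq (VectorMeasure.ext fun s hs => ?_)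
  rw [push, VectorMeasure.map_apply _ hΦ.measurable hs,
    SignedMeasure.apply_eq_posPart_real_sub_negPart_real _ (hΦ.measurable hs),
    JordanDecomposition.toSignedMeasure, Measure.toSignedMeasure_sub_apply hs,
    map_measureReal_apply hΦ.measurable hs, map_measureReal_apply hΦ.measurable hs]

theorem totalVariation_push (hΦ : MeasurableEmbedding Φ) (μ : SignedMeasure α) :
    (push Φ μ).totalVariation = μ.totalVariation.map Φ := by
  rw [SignedMeasure.totalVariation, (toJordanDecomposition_push hΦ μ).1,
    (toJordanDecomposition_push hΦ μ).2, SignedMeasure.totalVariation,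
    Measure.map_add _ _ hΦ.measurable]

theorem totalVariation_push_univ (hΦ : MeasurableEmbedding Φ) (μ : SignedMeasure α) :
    (push Φ μ).totalVariation univ = μ.totalVariation univ := by
  rw [totalVariation_push hΦ, Measure.map_apply hΦ.measurable .univ, preimage_univ]

end Push

theorem sintegral_push {Φ : Plane → Plane} (hΦ : MeasurableEmbedding Φ) (μ : SignedMeasure Plane)
    (f : Plane → F) : sintegral (push Φ μ) f = sintegral μ (fun x => f (Φ x)) := by
  simp only [sintegral, (toJordanDecomposition_push hΦ μ).1, (toJordanDecomposition_push hΦ μ).2,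
    hΦ.integral_map]

end SignedMeasure

section IntegralCurve

variable {E : Type*} [NormedAddCommGroup E] [NormedSpace ℝ E] [CompleteSpace E]

theorem exists_integralCurveOn_Ioo {v : ℝ → E → E} {B K : ℝ≥0} (hB : ∀ t x, ‖v t x‖ ≤ B)
    (hK : ∀ t, LipschitzWith K (v t)) (hc : ∀ x, Continuous fun t => v t x) (x₀ : E) (R : ℝ≥0) :
    ∃ α : ℝ → E, α 0 = x₀ ∧ ∀ t ∈ Ioo (-R : ℝ) R, HasDerivAt α (v t (α t)) t := by
  have hR : (0 : ℝ) ∈ Icc (-R : ℝ) R := ⟨neg_nonpos.2 R.2, R.2⟩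
  have hPL : IsPicardLindelof v (⟨0, hR⟩ : Icc (-R : ℝ) R) x₀ (B * R) 0 B K :=
    { lipschitzOnWith := fun t _ => (hK t).lipschitzOnWith
      continuousOn := fun x _ => (hc x).continuousOn
      norm_le := fun t _ x _ => hB t x
      mul_max_le := by simp }
  obtain ⟨α, hα₀, hα⟩ := hPL.exists_eq_forall_mem_Icc_hasDerivWithinAt₀
  exact ⟨α, hα₀, fun t ht => (hα t (Ioo_subset_Icc_self ht)).hasDerivAt (Icc_mem_nhds ht.1 ht.2)⟩

theorem exists_isIntegralCurve {v : ℝ → E → E} {B K : ℝ≥0} (hB : ∀ t x, ‖v t x‖ ≤ B)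
    (hK : ∀ t, LipschitzWith K (v t)) (hc : ∀ x, Continuous fun t => v t x) (x₀ : E) :
    ∃ α : ℝ → E, α 0 = x₀ ∧ IsIntegralCurve α v := by
  choose α hα₀ hα using exists_integralCurveOn_Ioo hB hK hc x₀
  have hmono {r s : ℝ≥0} (hrs : r ≤ s) : Ioo (-r : ℝ) r ⊆ Ioo (-s : ℝ) s :=
    Ioo_subset_Ioo (neg_le_neg hrs) hrs
  have heqOn {r s : ℝ≥0} (hrs : r ≤ s) : EqOn (α r) (α s) (Ioo (-r : ℝ) r) := by
    intro t ht
    have hr : (0 : ℝ) < r := by linarith [ht.1, ht.2]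
    exact ODE_solution_unique_of_mem_Ioo (s := fun _ => univ)
      (fun t _ => (hK t).lipschitzOnWith) ⟨neg_neg_iff_pos.2 hr, hr⟩
      (fun t ht => ⟨hα r t ht, trivial⟩) (fun t ht => ⟨hα s t (hmono hrs ht), trivial⟩)
      ((hα₀ r).trans (hα₀ s).symm) ht
  let radius (t : ℝ) : ℝ≥0 := ‖t‖₊ + 1
  have mem_radius (t : ℝ) : t ∈ Ioo (-radius t : ℝ) (radius t) :=
    abs_lt.1 (lt_add_one |t|)
  have eq_of_mem {r : ℝ≥0} {t : ℝ} (ht : t ∈ Ioo (-r : ℝ) r) : α (radius t) t = α r t :=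
    (le_total (radius t) r).elim (fun h => heqOn h (mem_radius t)) fun h => (heqOn h ht).symm
  refine ⟨fun t => α (radius t) t, hα₀ _, fun t => ?_⟩
  refine (hα _ t (mem_radius t)).congr_of_eventuallyEq ?_
  filter_upwards [isOpen_Ioo.mem_nhds (mem_radius t)] with s hs using eq_of_mem hs

end IntegralCurve

section Flow

variable {E : Type*} [NormedAddCommGroup E] [NormedSpace ℝ E]

/-- A time-dependent vector field that is smooth in space, with a common bound `L` for
the field, its Lipschitz constants in time and space and the Lipschitz constant of its spatial
derivative. -/
structure RegField (u : ℝ → E → E) (L : ℝ≥0) : Prop where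
  smooth : ∀ t, ContDiff ℝ ∞ (u t)
  bound : ∀ t x, ‖u t x‖ ≤ L
  fderiv_bound : ∀ t x, ‖fderiv ℝ (u t) x‖ ≤ L
  fderiv_lip : ∀ t x y, ‖fderiv ℝ (u t) x - fderiv ℝ (u t) y‖ ≤ L * ‖x - y‖
  time_lip : ∀ s t x, ‖u s x - u t x‖ ≤ L * |s - t|

/-- `X` is the flow of `u` started at time `0`. -/
structure IsFlow (u : ℝ → E → E) (X : ℝ → E → E) : Prop where
  zero : ∀ x, X 0 x = x
  isIntegralCurve : ∀ x, IsIntegralCurve (fun t => X t x) u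

variable {u : ℝ → E → E} {L : ℝ≥0} {X : ℝ → E → E}

theorem RegField.lipschitz (hu : RegField u L) (t : ℝ) : LipschitzWith L (u t) :=
  lipschitzWith_of_nnnorm_fderiv_le ((hu.smooth t).differentiable (by simp))
    fun x => hu.fderiv_bound t x

theorem RegField.norm_sub_le (hu : RegField u L) (t : ℝ) (x y : E) :
    ‖u t x - u t y‖ ≤ L * ‖x - y‖ := by
  simpa [dist_eq_norm] using (hu.lipschitz t).dist_le_mul x y

theorem RegField.continuous_time (hu : RegField u L) (x : E) : Continuous fun t => u t x :=
  (LipschitzWith.of_dist_le_mul (K := L) fun s t => by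
    simpa [dist_eq_norm, Real.norm_eq_abs] using hu.time_lip s t x).continuous

theorem RegField.exists_isFlow [CompleteSpace E] (hu : RegField u L) : ∃ X, IsFlow u X := by
  choose α hα₀ hα using exists_isIntegralCurve hu.bound hu.lipschitz hu.continuous_time
  exact ⟨fun t x => α x t, hα₀, hα⟩

theorem IsFlow.norm_sub_time_le (hX : IsFlow u X) (hu : RegField u L) (s t : ℝ) (x : E) :
    ‖X s x - X t x‖ ≤ L * |s - t| :=
  convex_univ.norm_image_sub_le_of_norm_hasDerivWithin_le (f := fun s => X s x)
    (fun r _ => (hX.isIntegralCurve x r).hasDerivWithinAt) (fun r _ => hu.bound r _) (mem_univ t)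
    (mem_univ s)

theorem RegField.reverse (hu : RegField u L) : RegField (fun t x => -u (-t) x) L where
  smooth t := (hu.smooth (-t)).neg
  bound t x := by simpa only [norm_neg] using hu.bound (-t) x
  fderiv_bound t x := by simpa only [fderiv_fun_neg, norm_neg] using hu.fderiv_bound (-t) x
  fderiv_lip t x y := by
    simpa only [fderiv_fun_neg, ← neg_sub', norm_neg] using hu.fderiv_lip (-t) x y
  time_lip s t x := by
    simpa only [← neg_sub', norm_neg, abs_neg] using hu.time_lip (-s) (-t) x

theorem IsFlow.reverse (hX : IsFlow u X) : IsFlow (fun t x => -u (-t) x) fun t => X (-t) where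
  zero x := by rw [neg_zero, hX.zero]
  isIntegralCurve x t := by
    simpa [Function.comp_def] using (hX.isIntegralCurve x (-t)).scomp t (hasDerivAt_neg t)

theorem IsFlow.norm_sub_space_le (hX : IsFlow u X) (hu : RegField u L) (t : ℝ) (x y : E) :
    ‖X t x - X t y‖ ≤ ‖x - y‖ * Real.exp (L * |t|) := by
  wlog ht : 0 ≤ t generalizing t u X
  · simpa only [neg_neg, abs_neg] using this hX.reverse hu.reverse (-t) (by linarith)
  have hdist := dist_le_of_trajectories_ODE (a := 0) (b := t) (δ := dist x y) hu.lipschitz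
    (hX.isIntegralCurve x).continuous.continuousOn
    (fun s _ => (hX.isIntegralCurve x s).hasDerivWithinAt)
    (hX.isIntegralCurve y).continuous.continuousOn
    (fun s _ => (hX.isIntegralCurve y s).hasDerivWithinAt)
    (by rw [hX.zero, hX.zero]) t ⟨ht, le_rfl⟩
  simpa only [dist_eq_norm, sub_zero, abs_of_nonneg ht] using hdist

theorem IsFlow.injective (hX : IsFlow u X) (hu : ∀ t, LipschitzWith L (u t)) (t : ℝ) :
    Function.Injective (X t) := by
  intro x y hxy
  have hcurves := ODE_solution_unique_univ (s := fun _ => univ) (t₀ := t)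
    (fun s => (hu s).lipschitzOnWith) (fun s => ⟨hX.isIntegralCurve x s, trivial⟩)
    (fun s => ⟨hX.isIntegralCurve y s, trivial⟩) hxy
  simpa only [hX.zero] using congrFun hcurves 0

theorem IsFlow.continuous (hX : IsFlow u X) (hu : RegField u L) :
    Continuous fun p : ℝ × E => X p.1 p.2 := by
  refine continuous_iff_continuousAt.2 fun ⟨t, x⟩ => tendsto_iff_dist_tendsto_zero.2 ?_
  have hbound (p : ℝ × E) :
      dist (X p.1 p.2) (X t x) ≤ ‖p.2 - x‖ * Real.exp (L * |p.1|) + L * |p.1 - t| := by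
    refine (dist_triangle _ (X p.1 x) _).trans ?_
    simp only [dist_eq_norm]
    exact add_le_add (hX.norm_sub_space_le hu _ _ _) (hX.norm_sub_time_le hu _ _ _)
  have hcont : Continuous fun p : ℝ × E =>
      ‖p.2 - x‖ * Real.exp (L * |p.1|) + L * |p.1 - t| := by fun_prop
  exact squeeze_zero (fun _ => dist_nonneg) hbound (by simpa using hcont.tendsto (t, x))

theorem IsFlow.continuous_space (hX : IsFlow u X) (hu : RegField u L) (t : ℝ) :
    Continuous (X t) :=
  (hX.continuous hu).comp (Continuous.prodMk_right t)

theorem IsFlow.measurableEmbedding [FiniteDimensional ℝ E] [MeasurableSpace E] [BorelSpace E]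
    (hX : IsFlow u X) (hu : RegField u L) (t : ℝ) : MeasurableEmbedding (X t) := by
  have : ProperSpace E := FiniteDimensional.proper_real E
  exact (hX.continuous_space hu t).measurableEmbedding (hX.injective hu.lipschitz t)

theorem IsFlow.norm_sub_euler_step_le (hX : IsFlow u X) (hu : RegField u L) {t h : ℝ}
    (hh : 0 ≤ h) (x : E) :
    ‖X (t + h) x - (X t x + h • u t (X t x))‖ ≤ (L + L * L) * h ^ 2 := by
  have hderiv : ∀ s ∈ Icc t (t + h), HasDerivWithinAt (fun s => X s x - s • u t (X t x))
      (u s (X s x) - u t (X t x)) (Icc t (t + h)) s := fun s _ => by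
    simpa only [id, one_smul] using ((hX.isIntegralCurve x s).fun_sub
      ((hasDerivAt_id s).smul_const (u t (X t x)))).hasDerivWithinAt
  have hbound : ∀ s ∈ Ico t (t + h), ‖u s (X s x) - u t (X t x)‖ ≤ (L + L * L) * h := fun s hs =>
    have hst : |s - t| ≤ h := abs_le.2 ⟨by linarith [hs.1], by linarith [hs.2]⟩
    calc ‖u s (X s x) - u t (X t x)‖
        ≤ ‖u s (X s x) - u t (X s x)‖ + ‖u t (X s x) - u t (X t x)‖ :=
          norm_sub_le_norm_sub_add_norm_sub _ _ _
      _ ≤ L * |s - t| + L * (L * |s - t|) := add_le_add (hu.time_lip _ _ _)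
          ((hu.norm_sub_le _ _ _).trans (by gcongr; exact hX.norm_sub_time_le hu _ _ _))
      _ = (L + L * L) * |s - t| := by ring
      _ ≤ (L + L * L) * h := by gcongr
  calc ‖X (t + h) x - (X t x + h • u t (X t x))‖
      = ‖X (t + h) x - (t + h) • u t (X t x) - (X t x - t • u t (X t x))‖ := by
        rw [add_smul]; congr 1; abel
    _ ≤ (L + L * L) * h * (t + h - t) :=
        norm_image_sub_le_of_norm_deriv_le_segment' hderiv hbound _ ⟨by linarith, le_rfl⟩
    _ = (L + L * L) * h ^ 2 := by ring

end Flow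

section TestFunction

variable {E : Type*} [NormedAddCommGroup E] [NormedSpace ℝ E] {φ : E → ℝ} {K r : ℝ}
  {u : ℝ → E → E} {L : ℝ≥0}

/-- Smooth test functions that vanish outside the ball of radius `r`, with a common bound `K` for
the derivative and for the Lipschitz constant of the derivative. -/
structure IsTest (φ : E → ℝ) (K r : ℝ) : Prop where
  smooth : ContDiff ℝ ∞ φ
  norm_fderiv_le : ∀ x, ‖fderiv ℝ φ x‖ ≤ K
  norm_fderiv_sub_le : ∀ x y, ‖fderiv ℝ φ x - fderiv ℝ φ y‖ ≤ K * ‖x - y‖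
  eq_zero : ∀ x, r < ‖x‖ → φ x = 0

theorem exists_norm_fderiv_le {F : Type*} [NormedAddCommGroup F] [NormedSpace ℝ F] {f : E → F}
    (hf : ContDiff ℝ ∞ f) (hc : HasCompactSupport f) : ∃ C, ∀ x, ‖fderiv ℝ f x‖ ≤ C :=
  (hc.fderiv ℝ).exists_bound_of_continuous (hf.continuous_fderiv (by simp))

theorem exists_isTest (hφ : ContDiff ℝ ∞ φ) (hc : HasCompactSupport φ) : ∃ K r, IsTest φ K r := by
  have hdφ : ContDiff ℝ ∞ (fderiv ℝ φ) := hφ.fderiv_right (by simp)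
  obtain ⟨A, hA⟩ := exists_norm_fderiv_le hφ hc
  obtain ⟨B, hB⟩ := exists_norm_fderiv_le hdφ (hc.fderiv ℝ)
  obtain ⟨r, hr⟩ := hc.isCompact.isBounded.subset_closedBall 0
  have hlip (x y : E) : ‖fderiv ℝ φ x - fderiv ℝ φ y‖ ≤ max A B * ‖x - y‖ :=
    convex_univ.norm_image_sub_le_of_norm_fderiv_le (𝕜 := ℝ) (f := fderiv ℝ φ)
      (fun z _ => hdφ.differentiable (by simp) z) (fun z _ => (hB z).trans (le_max_right A B))
      (mem_univ y) (mem_univ x)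
  exact ⟨max A B, r, hφ, fun x => (hA x).trans (le_max_left A B), hlip,
    fun x hx => image_eq_zero_of_notMem_tsupport fun hmem =>
      hx.not_ge (mem_closedBall_zero_iff.1 (hr hmem))⟩

namespace IsTest

theorem nonneg (hφ : IsTest φ K r) : 0 ≤ K := (norm_nonneg _).trans (hφ.norm_fderiv_le 0)

theorem mono {s : ℝ} (hφ : IsTest φ K r) (hrs : r ≤ s) : IsTest φ K s :=
  { hφ with eq_zero := fun x hx => hφ.eq_zero x (hrs.trans_lt hx) }

theorem hasCompactSupport [FiniteDimensional ℝ E] (hφ : IsTest φ K r) : HasCompactSupport φ :=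
  have : ProperSpace E := FiniteDimensional.proper_real E
  .intro (isCompact_closedBall 0 r) fun x hx => hφ.eq_zero x <| by
    simpa only [mem_closedBall_zero_iff, not_le] using hx

theorem abs_sub_le (hφ : IsTest φ K r) (x y : E) : |φ x - φ y| ≤ K * ‖x - y‖ :=
  convex_univ.norm_image_sub_le_of_norm_fderiv_le (𝕜 := ℝ)
    (fun z _ => hφ.smooth.differentiable (by simp) z) (fun z _ => hφ.norm_fderiv_le z)
    (mem_univ y) (mem_univ x)

theorem abs_taylor_le (hφ : IsTest φ K r) (x w : E) :
    |φ (x + w) - φ x - fderiv ℝ φ x w| ≤ K * ‖w‖ ^ 2 := by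
  have hbound := (convex_closedBall x ‖w‖).norm_image_sub_le_of_norm_hasFDerivWithin_le' (𝕜 := ℝ)
    (f := φ) (φ := fderiv ℝ φ x) (C := K * ‖w‖) (x := x) (y := x + w)
    (fun z _ => (hφ.smooth.differentiable (by simp) z).hasFDerivAt.hasFDerivWithinAt)
    (fun z hz => (hφ.norm_fderiv_sub_le z x).trans (mul_le_mul_of_nonneg_left
      (mem_closedBall_iff_norm.1 hz) hφ.nonneg))
    (Metric.mem_closedBall_self (norm_nonneg _)) (by simp)
  rw [add_sub_cancel_left, Real.norm_eq_abs] at hbound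
  exact hbound.trans_eq (by ring)

end IsTest

theorem RegField.norm_smul_le (hu : RegField u L) {h : ℝ} (hh : 0 ≤ h) (t : ℝ) (x : E) :
    ‖h • u t x‖ ≤ h * L := by
  rw [norm_smul, Real.norm_of_nonneg hh]
  exact mul_le_mul_of_nonneg_left (hu.bound t x) hh

theorem RegField.lt_norm_of_lt_norm_add_smul (hu : RegField u L) {h : ℝ} (hh : 0 ≤ h) (t : ℝ)
    {x : E} (hx : r + h * L < ‖x‖) : r < ‖x + h • u t x‖ := by
  have htri := _root_.norm_sub_le (x + h • u t x) (h • u t x)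
  rw [add_sub_cancel_right] at htri
  linarith [hu.norm_smul_le hh t x]

theorem RegField.hasFDerivAt_euler_step (hu : RegField u L) (h t : ℝ) (x : E) :
    HasFDerivAt (fun x => x + h • u t x)
      (ContinuousLinearMap.id ℝ E + h • fderiv ℝ (u t) x) x :=
  (hasFDerivAt_id x).add (((hu.smooth t).differentiable (by simp) x).hasFDerivAt.const_smul h)

theorem RegField.norm_fderiv_euler_step_le (hu : RegField u L) {h : ℝ} (hh : 0 ≤ h) (t : ℝ)
    (x : E) : ‖ContinuousLinearMap.id ℝ E + h • fderiv ℝ (u t) x‖ ≤ 1 + h * L := by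
  refine (norm_add_le _ _).trans (add_le_add ContinuousLinearMap.norm_id_le ?_)
  rw [norm_smul, Real.norm_of_nonneg hh]
  exact mul_le_mul_of_nonneg_left (hu.fderiv_bound t x) hh

theorem IsTest.fderiv_comp_euler_step (hφ : IsTest φ K r) (hu : RegField u L) (h t : ℝ) (x : E) :
    fderiv ℝ (fun x => φ (x + h • u t x)) x = (fderiv ℝ φ (x + h • u t x)).comp
      (ContinuousLinearMap.id ℝ E + h • fderiv ℝ (u t) x) :=
  ((hφ.smooth.differentiable (by simp) _).hasFDerivAt.comp x
    (hu.hasFDerivAt_euler_step h t x)).fderiv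

theorem IsTest.norm_fderiv_comp_euler_step_sub_le (hφ : IsTest φ K r) (hu : RegField u L) {h : ℝ}
    (hh : 0 ≤ h) (t : ℝ) (x y : E) :
    ‖fderiv ℝ (fun x => φ (x + h • u t x)) x - fderiv ℝ (fun x => φ (x + h • u t x)) y‖
      ≤ K * (1 + h * L) ^ 3 * ‖x - y‖ := by
  have hK := hφ.nonneg
  rw [hφ.fderiv_comp_euler_step hu, hφ.fderiv_comp_euler_step hu]
  set S : E → E := fun x => x + h • u t x
  set J : E → E →L[ℝ] E := fun x => ContinuousLinearMap.id ℝ E + h • fderiv ℝ (u t) x with hJ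
  have hSxy : ‖S x - S y‖ ≤ (1 + h * L) * ‖x - y‖ :=
    convex_univ.norm_image_sub_le_of_norm_hasFDerivWithin_le
      (fun z _ => (hu.hasFDerivAt_euler_step h t z).hasFDerivWithinAt)
      (fun z _ => hu.norm_fderiv_euler_step_le hh t z) (mem_univ y) (mem_univ x)
  have hJxy : ‖J x - J y‖ ≤ h * (L * ‖x - y‖) := by
    rw [hJ, add_sub_add_left_eq_sub, ← smul_sub, norm_smul, Real.norm_of_nonneg hh]
    exact mul_le_mul_of_nonneg_left (hu.fderiv_lip t x y) hh
  calc ‖(fderiv ℝ φ (S x)).comp (J x) - (fderiv ℝ φ (S y)).comp (J y)‖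
      = ‖(fderiv ℝ φ (S x) - fderiv ℝ φ (S y)).comp (J x)
          + (fderiv ℝ φ (S y)).comp (J x - J y)‖ := by
        rw [ContinuousLinearMap.sub_comp, ContinuousLinearMap.comp_sub, sub_add_sub_cancel]
    _ ≤ ‖fderiv ℝ φ (S x) - fderiv ℝ φ (S y)‖ * ‖J x‖ + ‖fderiv ℝ φ (S y)‖ * ‖J x - J y‖ :=
        (norm_add_le _ _).trans (add_le_add (ContinuousLinearMap.opNorm_comp_le _ _)
          (ContinuousLinearMap.opNorm_comp_le _ _))
    _ ≤ K * ((1 + h * L) * ‖x - y‖) * (1 + h * L) + K * (h * (L * ‖x - y‖)) := by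
        gcongr
        · exact (hφ.norm_fderiv_sub_le _ _).trans (mul_le_mul_of_nonneg_left hSxy hK)
        · exact hu.norm_fderiv_euler_step_le hh t x
        · exact hφ.norm_fderiv_le _
    _ = K * ((1 + h * L) ^ 2 + h * L * 1) * ‖x - y‖ := by ring
    _ ≤ K * ((1 + h * L) ^ 2 + h * L * (1 + h * L) ^ 2) * ‖x - y‖ := by
        gcongr
        exact one_le_pow₀ (le_add_of_nonneg_right (by positivity))
    _ = K * (1 + h * L) ^ 3 * ‖x - y‖ := by ring

theorem IsTest.comp_euler_step (hφ : IsTest φ K r) (hu : RegField u L) {h : ℝ} (hh : 0 ≤ h)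
    (t : ℝ) : IsTest (fun x => φ (x + h • u t x)) (K * Real.exp (3 * (h * L))) (r + h * L) := by
  have hK := hφ.nonneg
  have hexp : (1 + h * L) ^ 3 ≤ Real.exp (3 * (h * L)) := by
    rw [show (3 : ℝ) * (h * L) = (3 : ℕ) * (h * L) by norm_num, Real.exp_nat_mul, add_comm]
    gcongr
    exact Real.add_one_le_exp _
  refine ⟨hφ.smooth.comp (contDiff_id.add ((hu.smooth t).const_smul h)), fun x => ?_,
    fun x y => ?_, fun x hx => hφ.eq_zero _ (hu.lt_norm_of_lt_norm_add_smul hh t hx)⟩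
  · rw [hφ.fderiv_comp_euler_step hu]
    calc _ ≤ K * (1 + h * L) := (ContinuousLinearMap.opNorm_comp_le _ _).trans
          (mul_le_mul (hφ.norm_fderiv_le _) (hu.norm_fderiv_euler_step_le hh t x)
            (norm_nonneg _) hK)
      _ ≤ K * (1 + h * L) ^ 3 := by
          gcongr
          exact le_self_pow₀ (le_add_of_nonneg_right (by positivity)) three_ne_zero
      _ ≤ K * Real.exp (3 * (h * L)) := by gcongr
  · exact (hφ.norm_fderiv_comp_euler_step_sub_le hu hh t x y).trans (by gcongr)

end TestFunction

section Consistent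

variable {E : Type*} [NormedAddCommGroup E] [NormedSpace ℝ E] {φ : E → ℝ} {K r : ℝ}
  {u : ℝ → E → E} {L : ℝ≥0} {X : ℝ → E → E}

/-- A family of functionals `Λ t` on test functions is consistent with the transport by `u` if on
`[0, T]` it is dual, up to an error of second order in the step, to the explicit Euler scheme
for `u`. -/
def IsConsistent (u : ℝ → E → E) (T : ℝ) (Λ : ℝ → (E → ℝ) → ℝ) : Prop :=
  ∀ R : ℝ, ∃ C : ℝ, ∀ ⦃φ : E → ℝ⦄ ⦃K s h : ℝ⦄, IsTest φ K R → 0 ≤ s → 0 ≤ h → s + h ≤ T →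
    |Λ (s + h) φ - Λ s (fun x => φ (x + h • u s x))| ≤ C * K * h ^ 2

theorem abs_sub_le_of_euler_step_le {T C R : ℝ} {Λ Λ' : ℝ → (E → ℝ) → ℝ} (hu : RegField u L)
    (hC : ∀ ⦃φ : E → ℝ⦄ ⦃K s h : ℝ⦄, IsTest φ K R → 0 ≤ s → 0 ≤ h → s + h ≤ T →
      |Λ (s + h) φ - Λ s (fun x => φ (x + h • u s x))|
        + |Λ' (s + h) φ - Λ' s (fun x => φ (x + h • u s x))| ≤ C * K * h ^ 2)
    (h₀ : ∀ φ, Λ 0 φ = Λ' 0 φ) {h : ℝ} (hh : 0 ≤ h) (n : ℕ) (hT : n * h ≤ T)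
    (hφ : IsTest φ K r) (hr : r + n * h * L ≤ R) :
    |Λ (n * h) φ - Λ' (n * h) φ| ≤ n * (C * K * h ^ 2) * Real.exp (3 * (n * h * L)) := by
  induction n generalizing φ K r with
  | zero => simp [h₀]
  | succ n ih =>
    push_cast at hT hr ⊢
    rw [add_one_mul (n : ℝ) h] at hT hr ⊢
    have hrR : r ≤ R := le_trans (le_add_of_nonneg_right (by positivity)) hr
    have hstep := hC (hφ.mono hrR) (by positivity) hh hT
    have hind := ih (by linarith) (hφ.comp_euler_step hu hh (n * h)) (by linarith)
    have hone : 1 ≤ Real.exp (3 * ((n * h + h) * L)) := Real.one_le_exp (by positivity)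
    have herr := le_mul_of_one_le_right
      ((add_nonneg (abs_nonneg _) (abs_nonneg _)).trans hstep) hone
    set ψ : E → ℝ := fun x => φ (x + h • u (n * h) x)
    calc |Λ (n * h + h) φ - Λ' (n * h + h) φ|
        ≤ |Λ (n * h + h) φ - Λ (n * h) ψ| + |Λ (n * h) ψ - Λ' (n * h) ψ|
          + |Λ' (n * h) ψ - Λ' (n * h + h) φ| :=
          (abs_sub_le _ _ _).trans (add_le_add_left (abs_sub_le _ _ _) _)
      _ ≤ C * K * h ^ 2 * Real.exp (3 * ((n * h + h) * L))
          + n * (C * (K * Real.exp (3 * (h * L))) * h ^ 2) * Real.exp (3 * (n * h * L)) := by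
          rw [abs_sub_comm (Λ' _ ψ)]
          linarith
      _ = (n + 1) * (C * K * h ^ 2) * Real.exp (3 * ((n * h + h) * L)) := by
          rw [show 3 * ((n * h + h) * (L : ℝ)) = 3 * (h * L) + 3 * (n * h * L) by ring,
            Real.exp_add]
          ring

theorem IsConsistent.eq_of_isTest {T : ℝ} {Λ Λ' : ℝ → (E → ℝ) → ℝ} (hΛ : IsConsistent u T Λ)
    (hΛ' : IsConsistent u T Λ') (hu : RegField u L) (h₀ : ∀ φ, Λ 0 φ = Λ' 0 φ)
    (hφ : IsTest φ K r) {t : ℝ} (ht : t ∈ Icc 0 T) : Λ t φ = Λ' t φ := by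
  obtain ⟨C, hC⟩ := hΛ (r + t * L)
  obtain ⟨C', hC'⟩ := hΛ' (r + t * L)
  have hbound (n : ℕ) : |Λ t φ - Λ' t φ|
      ≤ (C + C') * K * t ^ 2 * Real.exp (3 * (t * L)) / (n + 1 : ℕ) := by
    have hmul : ((n + 1 : ℕ) : ℝ) * (t / (n + 1 : ℕ)) = t := mul_div_cancel₀ t (by positivity)
    have herr := abs_sub_le_of_euler_step_le (Λ := Λ) (Λ' := Λ') (T := T) (C := C + C') hu
      (fun ψ A s h hψ hs hh hsT => (add_le_add (hC hψ hs hh hsT) (hC' hψ hs hh hsT)).trans_eq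
        (by ring)) h₀ (h := t / (n + 1 : ℕ)) (div_nonneg ht.1 (by positivity)) (n + 1)
      (by rw [hmul]; exact ht.2) hφ (by rw [hmul])
    rw [hmul] at herr
    refine herr.trans_eq ?_
    field_simp
  have hlim := (tendsto_const_div_atTop_nhds_zero_nat
    ((C + C') * K * t ^ 2 * Real.exp (3 * (t * L)))).comp (tendsto_add_atTop_nat 1)
  exact eq_of_abs_sub_nonpos (ge_of_tendsto' hlim hbound)

theorem IsFlow.abs_comp_sub_le (hX : IsFlow u X) (hu : RegField u L) (hφ : IsTest φ K r) {s h : ℝ}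
    (hh : 0 ≤ h) (x : E) :
    |φ (X (s + h) x) - φ (X s x + h • u s (X s x))| ≤ (L + L * L) * K * h ^ 2 :=
  calc _ ≤ K * ‖X (s + h) x - (X s x + h • u s (X s x))‖ := hφ.abs_sub_le _ _
    _ ≤ K * ((L + L * L) * h ^ 2) :=
        mul_le_mul_of_nonneg_left (hX.norm_sub_euler_step_le hu hh x) hφ.nonneg
    _ = _ := by ring

theorem IsFlow.lt_norm (hX : IsFlow u X) (hu : RegField u L) {t : ℝ} (ht : 0 ≤ t) {x : E}
    (hx : r + t * L < ‖x‖) : r < ‖X t x‖ := by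
  have hdisp := hX.norm_sub_time_le hu 0 t x
  rw [hX.zero, zero_sub, abs_neg, abs_of_nonneg ht] at hdisp
  linarith [norm_le_norm_add_norm_sub' x (X t x)]

end Consistent

section Volume

variable {E : Type*} [NormedAddCommGroup E] [NormedSpace ℝ E] [FiniteDimensional ℝ E]
  [MeasurableSpace E] [BorelSpace E] {μ : Measure E} [μ.IsAddHaarMeasure]
  {φ : E → ℝ} {u : ℝ → E → E} {L : ℝ≥0} {X : ℝ → E → E}

theorem integral_fderiv_apply_eq_zero (hφ : ContDiff ℝ ∞ φ) (hc : HasCompactSupport φ)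
    {v : E → E} (hv : ContDiff ℝ ∞ v) (hdiv : ∀ x, LinearMap.trace ℝ E (fderiv ℝ v x) = 0) :
    ∫ x, fderiv ℝ φ x (v x) ∂μ = 0 := by
  let b := Module.finBasis ℝ E
  let coord (i) : E →L[ℝ] ℝ := LinearMap.toContinuousLinearMap (b.coord i)
  have hcoord (i) (x : E) : fderiv ℝ (fun x => coord i (v x)) x (b i)
      = coord i (fderiv ℝ v x (b i)) := by
    have h := ((coord i).hasFDerivAt.comp x (hv.differentiable (by simp) x).hasFDerivAt).fderiv
    exact congrArg (fun A : E →L[ℝ] ℝ => A (b i)) h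
  have hvi (i) : ContDiff ℝ ∞ fun x => coord i (v x) := (coord i).contDiff.comp hv
  have hcont (i) : Continuous fun x => fderiv ℝ φ x (b i) :=
    (hφ.continuous_fderiv (by simp)).clm_apply continuous_const
  have hsupp (i) : HasCompactSupport fun x => fderiv ℝ φ x (b i) := hc.fderiv_apply ℝ _
  have hint (i) : Integrable (fun x => coord i (v x) * fderiv ℝ φ x (b i)) μ :=
    ((hvi i).continuous.mul (hcont i)).integrable_of_hasCompactSupport (hsupp i).mul_left
  have hcont' (i) : Continuous fun x => fderiv ℝ (fun x => coord i (v x)) x (b i) :=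
    ((hvi i).continuous_fderiv (by simp)).clm_apply continuous_const
  have hint' (i) : Integrable (fun x => fderiv ℝ (fun x => coord i (v x)) x (b i) * φ x) μ :=
    ((hcont' i).mul hφ.continuous).integrable_of_hasCompactSupport hc.mul_left
  have hparts (i) : ∫ x, coord i (v x) * fderiv ℝ φ x (b i) ∂μ
      = -∫ x, fderiv ℝ (fun x => coord i (v x)) x (b i) * φ x ∂μ :=
    integral_mul_fderiv_eq_neg_fderiv_mul_of_integrable (hint' i) (hint i)
      (((hvi i).continuous.mul hφ.continuous).integrable_of_hasCompactSupport hc.mul_left)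
      (fun x _ => (hvi i).differentiable (by simp) x)
      (fun x _ => hφ.differentiable (by simp) x)
  calc ∫ x, fderiv ℝ φ x (v x) ∂μ = ∫ x, ∑ i, coord i (v x) * fderiv ℝ φ x (b i) ∂μ := by
        refine integral_congr_ae (Eventually.of_forall fun x => ?_)
        beta_reduce
        conv_lhs => rw [← b.sum_repr (v x), map_sum]
        simp [coord]
    _ = -∫ x, (∑ i, coord i (fderiv ℝ v x (b i))) * φ x ∂μ := by
        simp only [integral_finsetSum _ fun i _ => hint i, hparts, Finset.sum_neg_distrib,
          Finset.sum_mul, ← hcoord]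
        rw [integral_finsetSum _ fun i _ => hint' i]
    _ = 0 := by
        have htrace (x : E) : ∑ i, coord i (fderiv ℝ v x (b i)) = 0 := by
          rw [← hdiv x, LinearMap.trace_eq_matrix_trace ℝ b, Matrix.trace]
          simp [LinearMap.toMatrix_apply, coord]
        simp [htrace]

omit [BorelSpace E] in
theorem abs_integral_le_of_closedBall {f : E → ℝ} {C R : ℝ} (hf : ∀ x, |f x| ≤ C)
    (hR : ∀ x, R < ‖x‖ → f x = 0) : |∫ x, f x ∂μ| ≤ C * μ.real (Metric.closedBall 0 R) := by
  have : ProperSpace E := FiniteDimensional.proper_real E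
  rw [← setIntegral_eq_integral_of_forall_compl_eq_zero (s := Metric.closedBall 0 R) fun x hx =>
    hR x (by simpa only [mem_closedBall_zero_iff, not_le] using hx)]
  simp only [← Real.norm_eq_abs] at hf ⊢
  exact norm_setIntegral_le_of_norm_le_const measure_closedBall_lt_top fun x _ => hf x

theorem RegField.isConsistent_integral (hu : RegField u L)
    (hdiv : ∀ t x, LinearMap.trace ℝ E (fderiv ℝ (u t) x) = 0) (T : ℝ) :
    IsConsistent u T fun _ φ => ∫ x, φ x ∂μ := by
  intro R
  refine ⟨L ^ 2 * μ.real (Metric.closedBall 0 (R + T * L)), fun φ K s h hφ hs hh hT => ?_⟩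
  have hL : (0 : ℝ) ≤ L := L.2
  have hstep := hφ.comp_euler_step hu hh s
  have hintφ : Integrable φ μ :=
    hφ.smooth.continuous.integrable_of_hasCompactSupport hφ.hasCompactSupport
  have hintstep : Integrable (fun x => φ (x + h • u s x)) μ :=
    hstep.smooth.continuous.integrable_of_hasCompactSupport hstep.hasCompactSupport
  have hcont : Continuous fun x => fderiv ℝ φ x (h • u s x) :=
    (hφ.smooth.continuous_fderiv (by simp)).clm_apply ((hu.smooth s).continuous.const_smul h)
  have hfderiv_zero (x : E) (hx : R < ‖x‖) : fderiv ℝ φ x = 0 := by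
    refine (HasFDerivAt.congr_of_eventuallyEq (hasFDerivAt_const (0 : ℝ) x) ?_).fderiv
    filter_upwards [(isOpen_lt continuous_const continuous_norm).mem_nhds hx] with y hy
    exact hφ.eq_zero y hy
  have hintderiv : Integrable (fun x => fderiv ℝ φ x (h • u s x)) μ :=
    hcont.integrable_of_hasCompactSupport <| (hφ.hasCompactSupport.fderiv ℝ).mono fun x hx hzero =>
      hx (by simp only [hzero, zero_apply])
  have hzero : ∫ x, fderiv ℝ φ x (h • u s x) ∂μ = 0 := by
    simp only [map_smul, integral_smul, integral_fderiv_apply_eq_zero hφ.smooth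
      hφ.hasCompactSupport (hu.smooth s) (hdiv s), smul_zero]
  have hTaylor : |∫ x, (φ (x + h • u s x) - φ x - fderiv ℝ φ x (h • u s x)) ∂μ|
      ≤ K * (h * L) ^ 2 * μ.real (Metric.closedBall 0 (R + T * L)) := by
    refine abs_integral_le_of_closedBall (fun x => (hφ.abs_taylor_le x _).trans ?_) fun x hx => ?_
    · have hK := hφ.nonneg
      gcongr
      exact hu.norm_smul_le hh s x
    · have hhT : h * L ≤ T * L := mul_le_mul_of_nonneg_right (by linarith) hL
      have hxR : R < ‖x‖ := by linarith [mul_nonneg hh hL]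
      rw [hstep.eq_zero x (by linarith), hφ.eq_zero x hxR, hfderiv_zero x hxR]
      simp
  have hintsub : Integrable (fun x => φ (x + h • u s x) - φ x) μ := hintstep.sub hintφ
  rw [integral_sub hintsub hintderiv, integral_sub hintstep hintφ, hzero, sub_zero] at hTaylor
  change |∫ x, φ x ∂μ - ∫ x, φ (x + h • u s x) ∂μ| ≤ _
  rw [abs_sub_comm]
  exact hTaylor.trans_eq (by ring)

theorem IsFlow.isConsistent_integral (hX : IsFlow u X) (hu : RegField u L) (T : ℝ) :
    IsConsistent u T fun t φ => ∫ x, φ (X t x) ∂μ := by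
  intro R
  refine ⟨(L + L * L) * μ.real (Metric.closedBall 0 (R + T * L)),
    fun φ K s h hφ hs hh hT => ?_⟩
  have hstep := hφ.comp_euler_step hu hh s
  have hR : R + s * L + h * L ≤ R + T * L := by
    linarith [mul_le_mul_of_nonneg_right hT L.coe_nonneg]
  have hzero {x : E} (hx : R + T * L < ‖x‖) : φ (X (s + h) x) = 0 :=
    hφ.eq_zero _ (hX.lt_norm hu (add_nonneg hs hh) (by linarith))
  have hzero' {x : E} (hx : R + T * L < ‖x‖) : φ (X s x + h • u s (X s x)) = 0 :=
    hstep.eq_zero _ (hX.lt_norm hu hs (by linarith))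
  have hint {f : E → ℝ} (hf : Continuous f) (hf₀ : ∀ x, R + T * L < ‖x‖ → f x = 0) :
      Integrable f μ :=
    have : ProperSpace E := FiniteDimensional.proper_real E
    hf.integrable_of_hasCompactSupport <| .intro (isCompact_closedBall 0 (R + T * L)) fun x hx =>
      hf₀ x (by simpa only [mem_closedBall_zero_iff, not_le] using hx)
  have hint₁ : Integrable (fun x => φ (X (s + h) x)) μ :=
    hint (hφ.smooth.continuous.comp (hX.continuous_space hu _)) fun x => hzero
  have hint₂ : Integrable (fun x => φ (X s x + h • u s (X s x))) μ :=
    hint (hstep.smooth.continuous.comp (hX.continuous_space hu s)) fun x => hzero'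
  change |∫ x, φ (X (s + h) x) ∂μ - ∫ x, φ (X s x + h • u s (X s x)) ∂μ| ≤ _
  rw [← integral_sub hint₁ hint₂]
  refine (abs_integral_le_of_closedBall (hX.abs_comp_sub_le hu hφ hh) fun x hx => ?_).trans_eq
    (by ring)
  rw [hzero hx, hzero' hx, sub_self]

theorem IsFlow.measurePreserving (hX : IsFlow u X) (hu : RegField u L)
    (hdiv : ∀ t x, LinearMap.trace ℝ E (fderiv ℝ (u t) x) = 0) {t : ℝ} (ht : 0 ≤ t) :
    MeasurePreserving (X t) μ μ := by
  have : ProperSpace E := FiniteDimensional.proper_real E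
  have hXt := hX.measurableEmbedding hu t
  have hfinite : IsFiniteMeasureOnCompacts (μ.map (X t)) := ⟨fun S hS => by
    obtain ⟨R, hR⟩ := hS.isBounded.subset_closedBall 0
    rw [hXt.map_apply]
    refine (measure_mono (t := Metric.closedBall 0 (R + t * L)) fun x hx => ?_).trans_lt
      measure_closedBall_lt_top
    by_contra hxR
    rw [mem_closedBall_zero_iff, not_le] at hxR
    exact (hX.lt_norm hu ht hxR).not_ge (mem_closedBall_zero_iff.1 (hR hx))⟩
  refine ⟨hXt.measurable, measure_ext_of_integral_contDiff fun φ hφ hc => ?_⟩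
  obtain ⟨K, r, hφKr⟩ := exists_isTest hφ hc
  rw [hXt.integral_map]
  exact (hX.isConsistent_integral hu t).eq_of_isTest (hu.isConsistent_integral hdiv t) hu
    (fun ψ => by simp only [hX.zero]) hφKr ⟨ht, le_rfl⟩

end Volume

section SmoothBdd

/-- Smooth functions all of whose derivatives are bounded, the class of kernels considered. -/
structure SmoothBdd {E F : Type*} [NormedAddCommGroup E] [NormedSpace ℝ E]
    [NormedAddCommGroup F] [NormedSpace ℝ F] (f : E → F) : Prop where
  smooth : ContDiff ℝ ∞ f
  bounded : ∀ n : ℕ, ∃ C, ∀ x, ‖iteratedFDeriv ℝ n f x‖ ≤ C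

variable {E F : Type*} [NormedAddCommGroup E] [NormedSpace ℝ E]
  [NormedAddCommGroup F] [NormedSpace ℝ F] {f : E → F}

theorem SmoothBdd.fderiv (hf : SmoothBdd f) : SmoothBdd (fderiv ℝ f) where
  smooth := hf.smooth.fderiv_right (by simp)
  bounded n := by
    obtain ⟨C, hC⟩ := hf.bounded (n + 1)
    exact ⟨C, fun x => by rw [norm_iteratedFDeriv_fderiv]; exact hC x⟩

theorem SmoothBdd.exists_norm_le (hf : SmoothBdd f) : ∃ C, 0 ≤ C ∧ ∀ x, ‖f x‖ ≤ C := by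
  obtain ⟨C, hC⟩ := hf.bounded 0
  simp only [norm_iteratedFDeriv_zero] at hC
  exact ⟨C, (norm_nonneg _).trans (hC 0), hC⟩

end SmoothBdd

theorem norm_le_of_eLpNorm_top_le {X F : Type*} [TopologicalSpace X]
    [MeasurableSpace X] [NormedAddCommGroup F] {f : X → F} {μ : Measure X} [μ.IsOpenPosMeasure]
    (hf : Continuous f) {c : ℝ≥0} (h : eLpNorm f ⊤ μ ≤ c) (x : X) : ‖f x‖ ≤ c := by
  have hae : ∀ᵐ y ∂μ, ‖f y‖ ≤ c := by
    filter_upwards [ae_le_eLpNormEssSup (f := f) (μ := μ)] with y hy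
    exact_mod_cast hy.trans (eLpNorm_exponent_top (f := f) ▸ h)
  exact closure_minimal (t := {y | ‖f y‖ ≤ c}) subset_rfl (isClosed_le hf.norm continuous_const)
    (Measure.dense_of_ae hae x)

section Convolution

variable {E G : Type*} [NormedAddCommGroup E] [NormedSpace ℝ E] [FiniteDimensional ℝ E]
  [MeasurableSpace E] [BorelSpace E] {μ : Measure E} [μ.IsAddHaarMeasure]
  [NormedAddCommGroup G] [NormedSpace ℝ G]

theorem exists_norm_convolution_le {E' F : Type*} [NormedAddCommGroup E'] [NormedSpace ℝ E']
    [NormedAddCommGroup F] [NormedSpace ℝ F] {g : E → E'} (hg : Continuous g)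
    (hgc : HasCompactSupport g) {k : E → G} (hk : LocallyIntegrable k μ) {r C : ℝ}
    (hbound : ∀ x, r < ‖x‖ → ‖k x‖ ≤ C) (B : E' →L[ℝ] G →L[ℝ] F) :
    ∃ D, ∀ x, ‖convolution g k B μ x‖ ≤ D := by
  have : ProperSpace E := FiniteDimensional.proper_real E
  obtain ⟨A, hA⟩ := hgc.exists_bound_of_continuous hg
  let kloc : E → ℝ := (Metric.closedBall 0 r).indicator fun x => ‖k x‖
  have hkloc : Integrable kloc μ :=
    (integrable_indicator_iff Metric.isClosed_closedBall.measurableSet).2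
      (hk.integrableOn_isCompact (isCompact_closedBall 0 r)).norm
  have hkloc₀ (x : E) : 0 ≤ kloc x := indicator_nonneg (fun _ _ => norm_nonneg _) x
  have hle (x : E) : ‖k x‖ ≤ kloc x + |C| := by
    by_cases hx : x ∈ Metric.closedBall 0 r
    · simp only [kloc, indicator_of_mem hx]
      linarith [abs_nonneg C]
    · simp only [kloc, indicator_of_notMem hx, zero_add]
      rw [mem_closedBall_zero_iff, not_le] at hx
      exact (hbound x hx).trans (le_abs_self C)
  refine ⟨‖B‖ * (A * (∫ x, kloc x ∂μ) + (∫ x, ‖g x‖ ∂μ) * |C|), fun x => ?_⟩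
  have hint₁ : Integrable (fun y => A * kloc (x - y)) μ := (hkloc.comp_sub_left x).const_mul A
  have hint₂ : Integrable (fun y => ‖g y‖ * |C|) μ :=
    (hg.integrable_of_hasCompactSupport hgc).norm.mul_const _
  rw [convolution_def]
  refine (norm_integral_le_of_norm_le ((hint₁.add hint₂).const_mul ‖B‖)
    (Eventually.of_forall fun y => ?_)).trans_eq ?_
  · calc ‖B (g y) (k (x - y))‖ ≤ ‖B‖ * ‖g y‖ * ‖k (x - y)‖ := B.le_opNorm₂ _ _
      _ ≤ ‖B‖ * (‖g y‖ * (kloc (x - y) + |C|)) := by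
          rw [mul_assoc]
          gcongr
          exact hle _
      _ ≤ ‖B‖ * (A * kloc (x - y) + ‖g y‖ * |C|) := by
          rw [mul_add]
          gcongr
          exacts [hkloc₀ _, hA y]
  · simp only [Pi.add_apply]
    rw [integral_const_mul, integral_add hint₁ hint₂, integral_const_mul, integral_mul_const,
      integral_sub_left_eq_self kloc μ x]

theorem fderiv_convolution_left {E' F : Type*} [NormedAddCommGroup E'] [NormedSpace ℝ E']
    [NormedAddCommGroup F] [NormedSpace ℝ F] {g : E → E'} (hg : ContDiff ℝ 1 g)
    (hgc : HasCompactSupport g) {k : E → G} (hk : LocallyIntegrable k μ)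
    (B : E' →L[ℝ] G →L[ℝ] F) :
    fderiv ℝ (convolution g k B μ) = convolution (fderiv ℝ g) k (B.precompL E) μ :=
  funext fun x => (hgc.hasFDerivAt_convolution_left B hg hk x).fderiv

end Convolution

-- The induction replaces `F` by `E →L[ℝ] F`, which must stay in the same universe.
theorem exists_norm_iteratedFDeriv_convolution_le.{u} {E : Type u} {G : Type*}
    [NormedAddCommGroup E] [NormedSpace ℝ E] [FiniteDimensional ℝ E] [MeasurableSpace E]
    [BorelSpace E] {μ : Measure E} [μ.IsAddHaarMeasure] [NormedAddCommGroup G] [NormedSpace ℝ G]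
    {k : E → G} (hk : LocallyIntegrable k μ) {r C : ℝ} (hbound : ∀ x, r < ‖x‖ → ‖k x‖ ≤ C)
    (n : ℕ) {E' F : Type u} [NormedAddCommGroup E'] [NormedSpace ℝ E'] [NormedAddCommGroup F]
    [NormedSpace ℝ F] (B : E' →L[ℝ] G →L[ℝ] F) {g : E → E'} (hg : ContDiff ℝ ∞ g)
    (hgc : HasCompactSupport g) :
    ∃ D, ∀ x, ‖iteratedFDeriv ℝ n (convolution g k B μ) x‖ ≤ D := by
  induction n generalizing E' F with
  | zero =>
    simpa only [norm_iteratedFDeriv_zero] using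
      exists_norm_convolution_le hg.continuous hgc hk hbound B
  | succ n ih =>
    obtain ⟨D, hD⟩ := ih (B.precompL E) (hg.fderiv_right (by simp)) (hgc.fderiv ℝ)
    refine ⟨D, fun x => ?_⟩
    rw [← norm_iteratedFDeriv_fderiv, fderiv_convolution_left (hg.of_le (by simp)) hgc hk]
    exact hD x

theorem smoothBdd_convolution.{u} {E F : Type u} {G : Type*} [NormedAddCommGroup E]
    [NormedSpace ℝ E] [FiniteDimensional ℝ E] [MeasurableSpace E] [BorelSpace E] {μ : Measure E}
    [μ.IsAddHaarMeasure] [NormedAddCommGroup F] [NormedSpace ℝ F] [NormedAddCommGroup G]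
    [NormedSpace ℝ G] {E' : Type u} [NormedAddCommGroup E'] [NormedSpace ℝ E'] {k : E → G}
    (hk : LocallyIntegrable k μ) {r C : ℝ} (hbound : ∀ x, r < ‖x‖ → ‖k x‖ ≤ C)
    (B : E' →L[ℝ] G →L[ℝ] F) {g : E → E'} (hg : ContDiff ℝ ∞ g) (hgc : HasCompactSupport g) :
    SmoothBdd (convolution g k B μ) where
  smooth := hgc.contDiff_convolution_left B hg hk
  bounded n := exists_norm_iteratedFDeriv_convolution_le hk hbound n B hg hgc

section Divergence

variable {E : Type*} [NormedAddCommGroup E] [NormedSpace ℝ E] [FiniteDimensional ℝ E]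
  [MeasurableSpace E] [BorelSpace E] {μ : Measure E} [μ.IsAddHaarMeasure] {g : E → ℝ} {k : E → E}

theorem trace_fderiv_convolution (hg : ContDiff ℝ ∞ g) (hgc : HasCompactSupport g)
    (hk : LocallyIntegrable k μ) (x : E) :
    LinearMap.trace ℝ E (fderiv ℝ (convolution g k (ContinuousLinearMap.lsmul ℝ ℝ) μ) x)
      = ∫ y, fderiv ℝ g y (k (x - y)) ∂μ := by
  let traceL : (E →L[ℝ] E) →L[ℝ] ℝ := LinearMap.toContinuousLinearMap
    (LinearMap.trace ℝ E ∘ₗ ContinuousLinearMap.coeLM ℝ)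
  rw [fderiv_convolution_left (hg.of_le (by simp)) hgc hk, convolution_def]
  change traceL _ = _
  rw [← traceL.integral_comp_comm ((hgc.fderiv ℝ).convolutionExists_left _
    (hg.continuous_fderiv (by simp)) hk x)]
  exact integral_congr_ae (Eventually.of_forall fun y =>
    LinearMap.trace_smulRight (fderiv ℝ g y).toLinearMap (k (x - y)))

theorem trace_fderiv_convolution_eq_zero (hg : ContDiff ℝ ∞ g) (hgc : HasCompactSupport g)
    (hk : LocallyIntegrable k μ) {kn : ℕ → E → E} (hsmooth : ∀ n, ContDiff ℝ ∞ (kn n))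
    (hdiv : ∀ n x, LinearMap.trace ℝ E (fderiv ℝ (kn n) x) = 0) {b : E → ℝ}
    (hb : LocallyIntegrable b μ) (hle : ∀ n, ∀ᵐ x ∂μ, ‖kn n x‖ ≤ b x)
    (hlim : ∀ᵐ x ∂μ, Tendsto (fun n => kn n x) atTop (𝓝 (k x))) (x : E) :
    LinearMap.trace ℝ E (fderiv ℝ (convolution g k (ContinuousLinearMap.lsmul ℝ ℝ) μ) x) = 0 := by
  have hcont : Continuous (fderiv ℝ g) := hg.continuous_fderiv (by simp)
  have hsub : Measure.QuasiMeasurePreserving (fun y => x - y) μ μ :=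
    (Measure.measurePreserving_sub_left μ x).quasiMeasurePreserving
  have hzero (n : ℕ) : ∫ y, fderiv ℝ g y (kn n (x - y)) ∂μ = 0 := by
    refine integral_fderiv_apply_eq_zero hg hgc
      ((hsmooth n).comp (contDiff_const.sub contDiff_id)) fun y => ?_
    have hfderiv : fderiv ℝ (fun y => kn n (x - y)) y = _ :=
      (((hsmooth n).differentiable (by simp) (x - y)).hasFDerivAt.comp y
        ((hasFDerivAt_id y).const_sub x)).fderiv
    rw [hfderiv, ContinuousLinearMap.comp_neg, ContinuousLinearMap.comp_id,
      ContinuousLinearMap.toLinearMap_neg, map_neg, hdiv, neg_zero]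
  have hdom : Integrable (fun y => ‖fderiv ℝ g y‖ * b (x - y)) μ :=
    ((hgc.fderiv ℝ).norm.convolutionExists_left (ContinuousLinearMap.mul ℝ ℝ) hcont.norm hb x)
  rw [trace_fderiv_convolution hg hgc hk]
  refine tendsto_nhds_unique (tendsto_integral_of_dominated_convergence
    (F := fun n y => fderiv ℝ g y (kn n (x - y))) _
    (fun n => (hcont.clm_apply ((hsmooth n).continuous.comp
      (continuous_const.sub continuous_id))).aestronglyMeasurable) hdom (fun n => ?_) ?_)
    (tendsto_const_nhds.congr fun n => (hzero n).symm)
  · filter_upwards [hsub.ae (hle n)] with y hy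
    exact (fderiv ℝ g y).le_of_opNorm_le_of_le le_rfl hy
  · filter_upwards [hsub.ae hlim] with y hy
    exact ((fderiv ℝ g y).continuous.tendsto _).comp hy

end Divergence

theorem trace_fderiv_radial_smul_skew {E : Type*} [NormedAddCommGroup E] [InnerProductSpace ℝ E]
    [FiniteDimensional ℝ E] {c : ℝ → ℝ} {A : E →L[ℝ] E} (hA : ∀ x, inner ℝ x (A x) = 0)
    {x : E} (hc : DifferentiableAt ℝ c (‖x‖ ^ 2)) :
    LinearMap.trace ℝ E (fderiv ℝ (fun x => c (‖x‖ ^ 2) • A x) x) = 0 := by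
  have hradial := hc.hasFDerivAt.comp x (hasStrictFDerivAt_norm_sq x).hasFDerivAt
  have htrace : LinearMap.trace ℝ E A = 0 := by
    rw [LinearMap.trace_eq_sum_inner _ (stdOrthonormalBasis ℝ E)]
    exact Finset.sum_eq_zero fun i _ => hA _
  have hproduct : fderiv ℝ (fun x => c (‖x‖ ^ 2) • A x) x = _ :=
    (hradial.smul A.hasFDerivAt).fderiv
  have hsmulRight : LinearMap.trace ℝ E
      (((fderiv ℝ c (‖x‖ ^ 2)) ∘L (2 • innerSL ℝ x)).smulRight (A x)) = 0 := by
    refine (LinearMap.trace_smulRight (((fderiv ℝ c (‖x‖ ^ 2)) ∘L (2 • innerSL ℝ x)) : E →ₗ[ℝ] ℝ)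
      (A x)).trans ?_
    simp [hA]
  rw [hproduct, ContinuousLinearMap.toLinearMap_add, map_add, ContinuousLinearMap.toLinearMap_smul,
    map_smul, htrace, smul_zero, zero_add, hsmulRight]

section Kernel

variable {m κ δ ε : ℝ} {x : Plane} {ρ : Plane → ℝ} {k : Plane → Plane}

/-- The rotation of the plane by a right angle, which maps gradients to perpendicular gradients. -/
def quarterTurn : Plane →L[ℝ] Plane := Matrix.toEuclideanCLM (𝕜 := ℝ) !![0, -1; 1, 0]

theorem inner_quarterTurn (x : Plane) : inner ℝ x (quarterTurn x) = 0 := by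
  simp [quarterTurn, PiLp.inner_apply, Matrix.mulVec, dotProduct, Fin.sum_univ_two, mul_comm]

theorem norm_quarterTurn (x : Plane) : ‖quarterTurn x‖ = ‖x‖ := by
  simp [quarterTurn, EuclideanSpace.norm_eq, Matrix.mulVec, dotProduct, Fin.sum_univ_two, add_comm]

theorem perpGrad_eq_of_hasFDerivAt {f : Plane → ℝ} {v : Plane}
    (hf : HasFDerivAt f (innerSL ℝ v) x) : perpGrad f x = quarterTurn v := by
  ext i
  fin_cases i <;>
    simp [perpGrad, hf.fderiv, EuclideanSpace.inner_single_right, quarterTurn, Matrix.mulVec,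
      dotProduct, Fin.sum_univ_two]

/-- The kernel `kernel m κ` with `‖x‖ ^ 2` replaced by `‖x‖ ^ 2 + δ`, which smooths out the
singularity for `0 < δ`; `δ = 0` gives back `kernel m κ` off the origin. -/
def smoothKernel (m κ δ : ℝ) (x : Plane) : Plane :=
  (κ * (m - 2) * (‖x‖ ^ 2 + δ) ^ ((m - 4) / 2)) • quarterTurn x

theorem kernel_eq_smoothKernel (hx : x ≠ 0) : kernel m κ x = smoothKernel m κ 0 x := by
  have hgreen : green m κ = fun y => κ * (‖y‖ ^ 2) ^ ((m - 2) / 2) := by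
    funext y
    rw [← Real.rpow_natCast_mul (norm_nonneg y), Nat.cast_two, mul_div_cancel₀ _ two_ne_zero, green]
  rw [smoothKernel, ← map_smul]
  refine perpGrad_eq_of_hasFDerivAt ?_
  rw [hgreen]
  refine (((hasStrictFDerivAt_norm_sq x).hasFDerivAt.rpow_const (p := (m - 2) / 2)
    (.inl (by positivity))).const_mul κ).congr_fderiv ?_
  ext v
  simp only [smul_apply, smul_eq_mul, nsmul_eq_mul, innerSL_apply_apply, inner_smul_left,
    Real.ringHom_apply, Nat.cast_ofNat, add_zero, show (m - 2) / 2 - 1 = (m - 4) / 2 by ring]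
  ring

theorem norm_smoothKernel_le (hm : m < 2) (hδ : 0 ≤ δ) (hx : x ≠ 0) :
    ‖smoothKernel m κ δ x‖ ≤ |κ * (m - 2)| * ‖x‖ ^ (m - 3) := by
  have hx₀ : 0 < ‖x‖ := norm_pos_iff.2 hx
  rw [smoothKernel, norm_smul, norm_quarterTurn, norm_mul, Real.norm_eq_abs, Real.norm_eq_abs,
    abs_of_nonneg (a := (‖x‖ ^ 2 + δ) ^ ((m - 4) / 2)) (by positivity), mul_assoc]
  gcongr
  calc (‖x‖ ^ 2 + δ) ^ ((m - 4) / 2) * ‖x‖ ≤ (‖x‖ ^ 2) ^ ((m - 4) / 2) * ‖x‖ := by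
        gcongr ?_ * _
        exact Real.rpow_le_rpow_of_nonpos (by positivity) (by linarith) (by linarith)
    _ = ‖x‖ ^ (m - 3) := by
        rw [← Real.rpow_natCast_mul hx₀.le, ← Real.rpow_add_one hx₀.ne']
        congr 1
        push_cast
        ring

theorem contDiff_smoothKernel (hδ : 0 < δ) : ContDiff ℝ ∞ (smoothKernel m κ δ) :=
  (contDiff_const.mul (((contDiff_norm_sq ℝ).add contDiff_const).rpow_const_of_ne
    fun x => by positivity)).smul quarterTurn.contDiff

theorem trace_fderiv_smoothKernel (hδ : 0 < δ) (x : Plane) :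
    LinearMap.trace ℝ Plane (fderiv ℝ (smoothKernel m κ δ) x) = 0 :=
  trace_fderiv_radial_smul_skew (c := fun s => κ * (m - 2) * (s + δ) ^ ((m - 4) / 2))
    inner_quarterTurn (((differentiableAt_fun_id.add_const δ).rpow_const
      (.inl (show ‖x‖ ^ 2 + δ ≠ 0 by positivity))).const_mul _)

theorem tendsto_smoothKernel (hx : x ≠ 0) :
    Tendsto (fun n : ℕ => smoothKernel m κ (1 / ((n : ℝ) + 1)) x) atTop (𝓝 (kernel m κ x)) := by
  rw [kernel_eq_smoothKernel hx]
  refine (((tendsto_one_div_add_atTop_nhds_zero_nat.const_add _).rpow_const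
    (.inl (by simpa using hx))).const_mul _).smul_const _

theorem norm_kernel_le (hm : m < 2) (hx : x ≠ 0) :
    ‖kernel m κ x‖ ≤ |κ * (m - 2)| * ‖x‖ ^ (m - 3) := by
  rw [kernel_eq_smoothKernel hx]
  exact norm_smoothKernel_le hm le_rfl hx

theorem ae_ne_zero : ∀ᵐ x : Plane, x ≠ 0 := compl_mem_ae_iff.2 (measure_singleton 0)

theorem locallyIntegrable_norm_rpow (hm : 1 < m) :
    LocallyIntegrable fun x : Plane => ‖x‖ ^ (m - 3) := by
  refine locallyIntegrable_of_norm_le_rpow (C := 1) (α := 3 - m) (by simp) ?_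
    (Eventually.of_forall fun x => ?_) (measurable_norm.pow_const _).aestronglyMeasurable
  · rw [finrank_euclideanSpace_fin]
    push_cast
    linarith
  · rw [Real.norm_of_nonneg (by positivity), one_mul, neg_sub]

theorem locallyIntegrable_kernel (hm₁ : 1 < m) (hm : m < 2) : LocallyIntegrable (kernel m κ) := by
  have hmeas : AEStronglyMeasurable (kernel m κ) := aestronglyMeasurable_of_tendsto_ae atTop
    (fun n : ℕ => (contDiff_smoothKernel (by positivity)).continuous.aestronglyMeasurable)
    (ae_ne_zero.mono fun x hx => tendsto_smoothKernel hx)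
  refine ((locallyIntegrable_norm_rpow hm₁).smul (|κ * (m - 2)|)).mono hmeas ?_
  filter_upwards [ae_ne_zero] with x hx
  exact (norm_kernel_le hm hx).trans (le_abs_self _)

theorem IsMollifier.contDiff_rescale (hρ : IsMollifier ρ) (ε : ℝ) : ContDiff ℝ ∞ (rescale ρ ε) :=
  contDiff_const.mul (hρ.smooth.comp (contDiff_const_smul ε⁻¹))

theorem IsMollifier.hasCompactSupport_rescale (hρ : IsMollifier ρ) (hε : 0 < ε) :
    HasCompactSupport (rescale ρ ε) :=
  (hρ.compactSupport.comp_smul (inv_ne_zero hε.ne')).mul_left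

theorem smoothBdd_regKernel (hm₁ : 1 < m) (hm : m < 2) (hρ : IsMollifier ρ) (hε : 0 < ε) :
    SmoothBdd (regKernel m κ ρ ε) := by
  refine smoothBdd_convolution (r := 1) (C := |κ * (m - 2)|) (locallyIntegrable_kernel hm₁ hm)
    (fun x hx => ?_) _ (hρ.contDiff_rescale ε) (hρ.hasCompactSupport_rescale hε)
  exact (norm_kernel_le hm (norm_pos_iff.1 (one_pos.trans hx))).trans <|
    mul_le_of_le_one_right (abs_nonneg _)
      (Real.rpow_le_one_of_one_le_of_nonpos hx.le (by linarith))

theorem trace_fderiv_regKernel (hm₁ : 1 < m) (hm : m < 2) (hρ : IsMollifier ρ) (hε : 0 < ε)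
    (x : Plane) : LinearMap.trace ℝ Plane (fderiv ℝ (regKernel m κ ρ ε) x) = 0 :=
  trace_fderiv_convolution_eq_zero (hρ.contDiff_rescale ε) (hρ.hasCompactSupport_rescale hε)
    (locallyIntegrable_kernel hm₁ hm) (kn := fun n => smoothKernel m κ (1 / ((n : ℝ) + 1)))
    (fun _ => contDiff_smoothKernel (by positivity))
    (fun _ => trace_fderiv_smoothKernel (by positivity))
    ((locallyIntegrable_norm_rpow hm₁).smul (|κ * (m - 2)|))
    (fun _ => ae_ne_zero.mono fun _ hx => norm_smoothKernel_le hm (by positivity) hx)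
    (ae_ne_zero.mono fun _ hx => tendsto_smoothKernel hx) x

theorem kernelConst_ne_top (hk : SmoothBdd k) : kernelConst k ≠ ⊤ := by
  obtain ⟨C, -, hC⟩ := hk.exists_norm_le
  obtain ⟨C', -, hC'⟩ := hk.fderiv.exists_norm_le
  refine (max_lt (ENNReal.mul_lt_top ENNReal.ofNat_lt_top ?_) ?_).ne
  · exact (memLp_top_of_bound hk.smooth.continuous.aestronglyMeasurable C
      (Eventually.of_forall hC)).eLpNorm_lt_top
  · exact (memLp_top_of_bound hk.fderiv.smooth.continuous.aestronglyMeasurable C'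
      (Eventually.of_forall hC')).eLpNorm_lt_top

theorem lipschitzWith_kernelConst (hk : SmoothBdd k) :
    LipschitzWith (kernelConst k).toNNReal k := by
  have hle : eLpNorm (fderiv ℝ k) ⊤ volume ≤ (kernelConst k).toNNReal := by
    rw [ENNReal.coe_toNNReal (kernelConst_ne_top hk)]
    exact le_max_right _ _
  exact lipschitzWith_of_nnnorm_fderiv_le (hk.smooth.differentiable (by simp))
    (norm_le_of_eLpNorm_top_le hk.fderiv.smooth.continuous hle)

theorem norm_sub_le_kernelConst (hk : SmoothBdd k) (x y : Plane) :
    ‖k x - k y‖ ≤ (kernelConst k).toNNReal * min 1 ‖x - y‖ := by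
  set c := (kernelConst k).toNNReal
  have hc : (c : ℝ≥0∞) = kernelConst k := ENNReal.coe_toNNReal (kernelConst_ne_top hk)
  have hbound (x : Plane) : ‖k x‖ ≤ (c / 2 : ℝ≥0) := by
    refine norm_le_of_eLpNorm_top_le (μ := volume) hk.smooth.continuous ?_ x
    rw [ENNReal.coe_div two_ne_zero, ENNReal.le_div_iff_mul_le (by simp) (by simp), mul_comm, hc]
    exact le_max_left _ _
  rw [mul_min_of_nonneg _ _ c.coe_nonneg]
  refine le_min ?_ ((lipschitzWith_kernelConst hk).norm_sub_le x y)
  calc ‖k x - k y‖ ≤ ‖k x‖ + ‖k y‖ := norm_sub_le _ _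
    _ ≤ (c / 2 : ℝ≥0) + (c / 2 : ℝ≥0) := add_le_add (hbound x) (hbound y)
    _ = c * 1 := by push_cast; ring

end Kernel

section SignedConvolution

variable {F : Type} [NormedAddCommGroup F] [NormedSpace ℝ F] {f : Plane → F}
  {μ : SignedMeasure Plane} {C M : ℝ}

/-- The convolution of a function with a signed measure; `velocity` is the case of plane valued
functions. -/
def sconv (μ : SignedMeasure Plane) (f : Plane → F) (x : Plane) : F :=
  sintegral μ fun y => f (x - y)

theorem velocity_eq_sconv (k : Plane → Plane) (μ : SignedMeasure Plane) :
    velocity k μ = sconv μ k := rfl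

theorem SmoothBdd.integrable_comp_sub (hf : SmoothBdd f) (ν : Measure Plane) [IsFiniteMeasure ν]
    (x : Plane) : Integrable (fun y => f (x - y)) ν := by
  obtain ⟨C, -, hC⟩ := hf.exists_norm_le
  exact integrable_of_continuous_of_norm_le
    (hf.smooth.continuous.comp (continuous_const.sub continuous_id)) fun y => hC (x - y)

theorem SmoothBdd.hasFDerivAt_integral_comp_sub (hf : SmoothBdd f) (ν : Measure Plane)
    [IsFiniteMeasure ν] (x : Plane) :
    HasFDerivAt (fun x => ∫ y, f (x - y) ∂ν) (∫ y, _root_.fderiv ℝ f (x - y) ∂ν) x := by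
  obtain ⟨C, -, hC⟩ := hf.fderiv.exists_norm_le
  refine hasFDerivAt_integral_of_dominated_of_fderiv_le (s := univ) (bound := fun _ => C)
    (F' := fun x y => _root_.fderiv ℝ f (x - y)) univ_mem
    (Eventually.of_forall fun x => (hf.integrable_comp_sub ν x).aestronglyMeasurable)
    (hf.integrable_comp_sub ν x) (hf.fderiv.integrable_comp_sub ν x).aestronglyMeasurable
    (Eventually.of_forall fun y z _ => hC _) (integrable_const C)
    (Eventually.of_forall fun y z _ => ?_)
  exact ((hf.smooth.differentiable (by simp)) (z - y)).hasFDerivAt.comp z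
    ((hasFDerivAt_id z).sub_const y)

theorem SmoothBdd.hasFDerivAt_sconv (hf : SmoothBdd f) (μ : SignedMeasure Plane) (x : Plane) :
    HasFDerivAt (sconv μ f) (sconv μ (_root_.fderiv ℝ f) x) x :=
  (hf.hasFDerivAt_integral_comp_sub _ x).sub (hf.hasFDerivAt_integral_comp_sub _ x)

theorem SmoothBdd.fderiv_sconv (hf : SmoothBdd f) (μ : SignedMeasure Plane) :
    _root_.fderiv ℝ (sconv μ f) = sconv μ (_root_.fderiv ℝ f) :=
  funext fun x => (hf.hasFDerivAt_sconv μ x).fderiv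

theorem SmoothBdd.contDiff_sconv (hf : SmoothBdd f) (μ : SignedMeasure Plane) :
    ContDiff ℝ ∞ (sconv μ f) := by
  refine contDiff_infty.2 fun n => ?_
  induction n generalizing F with
  | zero => exact contDiff_zero.2 (continuous_iff_continuousAt.2 fun x =>
      (hf.hasFDerivAt_sconv μ x).continuousAt)
  | succ n ih => exact contDiff_succ_iff_hasFDerivAt.2 ⟨_, ih hf.fderiv, hf.hasFDerivAt_sconv μ⟩

theorem norm_sconv_le (hC : ∀ x, ‖f x‖ ≤ C) (hM : μ.totalVariation.real univ ≤ M) (x : Plane) :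
    ‖sconv μ f x‖ ≤ C * M :=
  norm_sintegral_le (fun _ => hC _) hM

theorem SmoothBdd.norm_sconv_sub_le (hf : SmoothBdd f) (hC : ∀ x, ‖_root_.fderiv ℝ f x‖ ≤ C)
    (hM : μ.totalVariation.real univ ≤ M) (x y : Plane) :
    ‖sconv μ f x - sconv μ f y‖ ≤ C * M * ‖x - y‖ :=
  convex_univ.norm_image_sub_le_of_norm_hasFDerivWithin_le
    (fun z _ => (hf.hasFDerivAt_sconv μ z).hasFDerivWithinAt)
    (fun z _ => norm_sconv_le hC hM z) (mem_univ y) (mem_univ x)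

theorem map_sintegral {G : Type*} [NormedAddCommGroup G] [NormedSpace ℝ G]
    [CompleteSpace F] [CompleteSpace G] (A : F →L[ℝ] G)
    (hf : Integrable f μ.totalVariation) : A (sintegral μ f) = sintegral μ fun x => A (f x) := by
  rw [integrable_totalVariation_iff] at hf
  simp only [sintegral, map_sub, A.integral_comp_comm hf.1, A.integral_comp_comm hf.2]

theorem trace_fderiv_velocity {k : Plane → Plane} (hk : SmoothBdd k)
    (hdiv : ∀ x, LinearMap.trace ℝ Plane (fderiv ℝ k x) = 0) (μ : SignedMeasure Plane)
    (x : Plane) : LinearMap.trace ℝ Plane (fderiv ℝ (velocity k μ) x) = 0 := by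
  let traceL : (Plane →L[ℝ] Plane) →L[ℝ] ℝ := LinearMap.toContinuousLinearMap
    (LinearMap.trace ℝ Plane ∘ₗ ContinuousLinearMap.coeLM ℝ)
  rw [velocity_eq_sconv, hk.fderiv_sconv]
  calc traceL (sconv μ (fderiv ℝ k) x) = sintegral μ fun y => traceL (fderiv ℝ k (x - y)) :=
        map_sintegral traceL (hk.fderiv.integrable_comp_sub _ x)
    _ = 0 := by
        have hzero (y : Plane) : traceL (fderiv ℝ k y) = 0 := hdiv y
        simp [hzero, sintegral]

end SignedConvolution

section ContinuityEquation

theorem exists_cutoff : ∃ (D : ℝ) (χ : ℕ → Plane → ℝ), (∀ n, ContDiff ℝ ∞ (χ n)) ∧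
    (∀ n, HasCompactSupport (χ n)) ∧ (∀ n x, |χ n x| ≤ 1) ∧
    (∀ n x, ‖fderiv ℝ (χ n) x‖ ≤ D / (n + 1)) ∧
    ∀ x, Tendsto (fun n => χ n x) atTop (𝓝 1) := by
  let χ : ContDiffBump (0 : Plane) := ⟨1, 2, one_pos, one_lt_two⟩
  have hχ : ContDiff ℝ ∞ χ := χ.contDiff
  obtain ⟨D, hD⟩ := (χ.hasCompactSupport.fderiv ℝ).exists_bound_of_continuous
    (hχ.continuous_fderiv (by simp))
  refine ⟨D, fun n x => χ (((n : ℝ) + 1)⁻¹ • x), fun n => hχ.comp (contDiff_const_smul _),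
    fun n => χ.hasCompactSupport.comp_smul (by positivity), fun n x => ?_, fun n x => ?_,
    fun x => ?_⟩
  · rw [abs_of_nonneg χ.nonneg]
    exact χ.le_one
  · rw [fderiv_comp_smul, norm_smul, Real.norm_of_nonneg (by positivity), div_eq_inv_mul]
    gcongr
    exact hD _
  · obtain ⟨N, hN⟩ := exists_nat_ge ‖x‖
    refine tendsto_const_nhds.congr' ?_
    filter_upwards [eventually_ge_atTop N] with n hn
    have hn' : (N : ℝ) ≤ n := by exact_mod_cast hn
    refine (χ.one_of_mem_closedBall ?_).symm
    rw [mem_closedBall_zero_iff, norm_smul, Real.norm_of_nonneg (by positivity),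
      inv_mul_le_iff₀ (by positivity)]
    change ‖x‖ ≤ ((n : ℝ) + 1) * 1
    linarith

/-- `θ` solves on `[0, T]`, in the sense of distributions, the linear continuity equation with the
given velocity field `u`, and its total variation is bounded by `M`. -/
structure IsLinearSolution (u : ℝ → Plane → Plane) (θ : ℝ → SignedMeasure Plane) (T M : ℝ) :
    Prop where
  bound : ∀ t ∈ Icc 0 T, (θ t).totalVariation.real univ ≤ M
  integrable : ∀ φ : Plane → ℝ, ContDiff ℝ ∞ φ → HasCompactSupport φ →
    ∀ s ∈ Icc 0 T, ∀ t ∈ Icc 0 T, IntervalIntegrable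
      (fun r => sintegral (θ r) fun x => fderiv ℝ φ x (u r x)) volume s t
  weak_eq : ∀ φ : Plane → ℝ, ContDiff ℝ ∞ φ → HasCompactSupport φ →
    ∀ s ∈ Icc 0 T, ∀ t ∈ Icc 0 T, sintegral (θ t) φ - sintegral (θ s) φ
      = ∫ r in s..t, sintegral (θ r) fun x => fderiv ℝ φ x (u r x)

variable {u : ℝ → Plane → Plane} {θ : ℝ → SignedMeasure Plane} {T M B A s t : ℝ}
  {k : Plane → Plane} {θ₀ : SignedMeasure Plane} {φ : Plane → ℝ}

theorem IsSolution.zero (h : IsSolution k θ₀ θ) : θ 0 = θ₀ :=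
  signedMeasure_ext_of_sintegral_contDiff fun φ hφ hc => by
    simpa only [intervalIntegral.integral_same, sub_eq_zero] using h.weak_eq φ hφ hc 0 le_rfl

theorem IsSolution.isLinearSolution (h : IsSolution k θ₀ θ)
    (hM : ∀ t ∈ Icc 0 T, (θ t).totalVariation.real univ ≤ M) :
    IsLinearSolution (fun t => velocity k (θ t)) θ T M where
  bound := hM
  integrable φ hφ hc s hs t ht :=
    (h.integrable φ hφ hc s hs.1).symm.trans (h.integrable φ hφ hc t ht.1)
  weak_eq φ hφ hc s hs t ht := by
    rw [← intervalIntegral.integral_interval_sub_left (h.integrable φ hφ hc t ht.1)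
      (h.integrable φ hφ hc s hs.1), ← h.weak_eq φ hφ hc t ht.1, ← h.weak_eq φ hφ hc s hs.1]
    ring

namespace IsLinearSolution

theorem congr {v : ℝ → Plane → Plane} (h : IsLinearSolution u θ T M)
    (huv : ∀ t ∈ Icc 0 T, u t = v t) : IsLinearSolution v θ T M where
  bound := h.bound
  integrable φ hφ hc s hs t ht := (h.integrable φ hφ hc s hs t ht).congr fun r hr => by
    simp only [huv r (uIcc_subset_Icc hs ht (uIoc_subset_uIcc hr))]
  weak_eq φ hφ hc s hs t ht := by
    rw [h.weak_eq φ hφ hc s hs t ht]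
    refine intervalIntegral.integral_congr fun r hr => ?_
    simp only [huv r (uIcc_subset_Icc hs ht hr)]

theorem abs_sub_le_of_hasCompactSupport (h : IsLinearSolution u θ T M)
    (hu : ∀ t ∈ Icc 0 T, ∀ x, ‖u t x‖ ≤ B) (hφ : ContDiff ℝ ∞ φ) (hc : HasCompactSupport φ)
    (hA : ∀ x, ‖fderiv ℝ φ x‖ ≤ A) (hs : s ∈ Icc 0 T) (ht : t ∈ Icc 0 T) :
    |sintegral (θ t) φ - sintegral (θ s) φ| ≤ A * B * M * |t - s| := by
  rw [h.weak_eq φ hφ hc s hs t ht, ← Real.norm_eq_abs]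
  refine intervalIntegral.norm_integral_le_of_norm_le_const fun r hr => ?_
  have hr' : r ∈ Icc 0 T := uIcc_subset_Icc hs ht (uIoc_subset_uIcc hr)
  exact norm_sintegral_le (fun x => (fderiv ℝ φ x).le_of_opNorm_le_of_le (hA x) (hu r hr' x))
    (h.bound r hr')

theorem abs_sub_le (h : IsLinearSolution u θ T M) (hu : ∀ t ∈ Icc 0 T, ∀ x, ‖u t x‖ ≤ B)
    (hφ : ContDiff ℝ ∞ φ) {C : ℝ} (hC : ∀ x, ‖φ x‖ ≤ C) (hA : ∀ x, ‖fderiv ℝ φ x‖ ≤ A)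
    (hs : s ∈ Icc 0 T) (ht : t ∈ Icc 0 T) :
    |sintegral (θ t) φ - sintegral (θ s) φ| ≤ A * B * M * |t - s| := by
  obtain ⟨D, χ, hχ, hχc, hχ_le, hχD, hχ_lim⟩ := exists_cutoff
  have hC₀ : 0 ≤ C := (norm_nonneg _).trans (hC 0)
  have hfderiv (n : ℕ) (x : Plane) :
      ‖fderiv ℝ (fun y => φ y * χ n y) x‖ ≤ C * (D / (n + 1)) + A := by
    rw [fderiv_fun_mul (hφ.differentiable (by simp) x) ((hχ n).differentiable (by simp) x)]
    refine (norm_add_le _ _).trans (add_le_add ?_ ?_) <;> rw [norm_smul]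
    · exact mul_le_mul (hC x) (hχD n x) (norm_nonneg _) hC₀
    · exact (mul_le_of_le_one_left (norm_nonneg _) (hχ_le n x)).trans (hA x)
  have hconv (μ : SignedMeasure Plane) :
      Tendsto (fun n => sintegral μ fun y => φ y * χ n y) atTop (𝓝 (sintegral μ φ)) := by
    refine tendsto_sintegral_of_norm_le μ (C := C)
      (fun n => hφ.continuous.mul (hχ n).continuous) (fun n x => ?_) (fun x => ?_)
    · rw [norm_mul]
      exact (mul_le_of_le_one_right (norm_nonneg _) (hχ_le n x)).trans (hC x)
    · simpa using (hχ_lim x).const_mul (φ x)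
  have hbound : Tendsto (fun n : ℕ => (C * (D / (n + 1)) + A) * B * M * |t - s|) atTop
      (𝓝 ((C * 0 + A) * B * M * |t - s|)) := by
    have hD : Tendsto (fun n : ℕ => D / ((n : ℝ) + 1)) atTop (𝓝 0) :=
      tendsto_const_nhds.div_atTop (tendsto_natCast_atTop_atTop.atTop_add tendsto_const_nhds)
    exact ((((hD.const_mul C).add_const A).mul_const B).mul_const M).mul_const _
  rw [mul_zero, zero_add] at hbound
  exact le_of_tendsto_of_tendsto' ((hconv _).sub (hconv _)).abs hbound fun n =>
    h.abs_sub_le_of_hasCompactSupport hu (hφ.mul (hχ n)) (hχc n).mul_left (hfderiv n) hs ht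

theorem norm_velocity_sub_le (h : IsLinearSolution u θ T M)
    (hu : ∀ t ∈ Icc 0 T, ∀ x, ‖u t x‖ ≤ B) (hk : SmoothBdd k) (hA : ∀ x, ‖fderiv ℝ k x‖ ≤ A)
    (hs : s ∈ Icc 0 T) (ht : t ∈ Icc 0 T) (x : Plane) :
    ‖velocity k (θ t) x - velocity k (θ s) x‖ ≤ A * B * M * |t - s| := by
  set w := velocity k (θ t) x - velocity k (θ s) x with hw
  let φ : Plane → ℝ := fun y => innerSL ℝ w (k (x - y))
  have hinner (μ : SignedMeasure Plane) : innerSL ℝ w (velocity k μ x) = sintegral μ φ :=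
    map_sintegral (innerSL ℝ w) (hk.integrable_comp_sub _ x)
  have hφ : ContDiff ℝ ∞ φ :=
    (innerSL ℝ w).contDiff.comp (hk.smooth.comp (contDiff_const.sub contDiff_id))
  have hφ_fderiv (y : Plane) : ‖fderiv ℝ φ y‖ ≤ ‖w‖ * A := by
    have hderiv : fderiv ℝ φ y = _ := ((innerSL ℝ w).hasFDerivAt.comp y
      ((hk.smooth.differentiable (by simp) (x - y)).hasFDerivAt.comp y
        ((hasFDerivAt_id y).const_sub x))).fderiv
    rw [hderiv, ContinuousLinearMap.comp_neg, ContinuousLinearMap.comp_id,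
      ContinuousLinearMap.comp_neg, norm_neg, ← innerSL_apply_norm (𝕜 := ℝ) w]
    exact (ContinuousLinearMap.opNorm_comp_le _ _).trans (by gcongr; exact hA _)
  obtain ⟨C, -, hC⟩ := hk.exists_norm_le
  have hφ_norm (y : Plane) : ‖φ y‖ ≤ ‖w‖ * C :=
    (innerSL ℝ w).le_of_opNorm_le_of_le (innerSL_apply_norm (𝕜 := ℝ) w).le (hC _)
  have hsq : ‖w‖ * ‖w‖ ≤ ‖w‖ * (A * B * M * |t - s|) := by
    have hle := (le_abs_self _).trans (h.abs_sub_le hu hφ hφ_norm hφ_fderiv hs ht)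
    rw [← hinner, ← hinner, ← map_sub, ← hw, innerSL_apply_apply,
      real_inner_self_eq_norm_mul_norm] at hle
    exact hle.trans_eq (by ring)
  rcases (norm_nonneg w).eq_or_lt with hw₀ | hw₀
  · have hA₀ : 0 ≤ A := (norm_nonneg _).trans (hA 0)
    have hB₀ : 0 ≤ B := (norm_nonneg _).trans (hu s hs 0)
    have hM₀ : 0 ≤ M := measureReal_nonneg.trans (h.bound s hs)
    rw [← hw₀]
    positivity
  · exact le_of_mul_le_mul_left hsq hw₀

end IsLinearSolution

theorem IsSolution.exists_regField (hk : SmoothBdd k) (h : IsSolution k θ₀ θ) (hT : 0 ≤ T)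
    (hM : ∀ t ∈ Icc 0 T, (θ t).totalVariation.real univ ≤ M) :
    ∃ L : ℝ≥0, RegField (fun t => velocity k (θ (projIcc 0 T hT t))) L := by
  obtain ⟨K₀, hK₀, hk₀⟩ := hk.exists_norm_le
  obtain ⟨K₁, hK₁, hk₁⟩ := hk.fderiv.exists_norm_le
  obtain ⟨K₂, hK₂, hk₂⟩ := hk.fderiv.fderiv.exists_norm_le
  have hM₀ : 0 ≤ M := measureReal_nonneg.trans (hM 0 ⟨le_rfl, hT⟩)
  have hmem (t : ℝ) : (projIcc 0 T hT t : ℝ) ∈ Icc 0 T := (projIcc 0 T hT t).2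
  have h₀ : 0 ≤ K₀ * M := mul_nonneg hK₀ hM₀
  have h₁ : 0 ≤ K₁ * M := mul_nonneg hK₁ hM₀
  have h₂ : 0 ≤ K₂ * M := mul_nonneg hK₂ hM₀
  have h₃ : 0 ≤ K₁ * (K₀ * M) * M := by positivity
  obtain ⟨L, hL⟩ : ∃ L : ℝ≥0, (L : ℝ) = K₀ * M + K₁ * M + K₂ * M + K₁ * (K₀ * M) * M :=
    ⟨⟨_, by positivity⟩, rfl⟩
  refine ⟨L, fun t => hk.contDiff_sconv _,
    fun t x => (norm_sconv_le hk₀ (hM _ (hmem t)) x).trans (by linarith), fun t x => ?_,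
    fun t x y => ?_, fun s t x => ?_⟩
  · rw [velocity_eq_sconv, hk.fderiv_sconv]
    exact (norm_sconv_le hk₁ (hM _ (hmem t)) x).trans (by linarith)
  · rw [velocity_eq_sconv, hk.fderiv_sconv]
    exact (hk.fderiv.norm_sconv_sub_le hk₂ (hM _ (hmem t)) x y).trans (by gcongr; linarith)
  · exact ((h.isLinearSolution hM).norm_velocity_sub_le
      (fun r hr => norm_sconv_le hk₀ (hM r hr)) hk hk₁ (hmem t) (hmem s) x).trans
      (mul_le_mul (by linarith) (abs_projIcc_sub_projIcc hT) (abs_nonneg _) L.2)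

end ContinuityEquation

section Duality

variable {u : ℝ → Plane → Plane} {L : ℝ≥0} {X : ℝ → Plane → Plane} {θ : ℝ → SignedMeasure Plane}
  {T M : ℝ} {φ : Plane → ℝ} {K R : ℝ} {k : Plane → Plane} {θ₀ : SignedMeasure Plane}

namespace IsTest

theorem norm_fderiv_apply_le (hφ : IsTest φ K R) (hu : RegField u L) (t : ℝ) (x : Plane) :
    ‖fderiv ℝ φ x (u t x)‖ ≤ K * L :=
  (fderiv ℝ φ x).le_of_opNorm_le_of_le (hφ.norm_fderiv_le x) (hu.bound t x)

theorem integrable_fderiv_apply (hφ : IsTest φ K R) (hu : RegField u L) (t : ℝ)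
    (μ : SignedMeasure Plane) :
    Integrable (fun x => fderiv ℝ φ x (u t x)) μ.totalVariation :=
  integrable_of_continuous_of_norm_le
    ((hφ.smooth.continuous_fderiv (by simp)).clm_apply (hu.smooth t).continuous)
    (hφ.norm_fderiv_apply_le hu t)

theorem norm_fderiv_apply_sub_le (hφ : IsTest φ K R) (hu : RegField u L) (t : ℝ) (x y : Plane) :
    ‖fderiv ℝ φ x (u t x) - fderiv ℝ φ y (u t y)‖ ≤ 2 * K * L * ‖x - y‖ := by
  calc ‖fderiv ℝ φ x (u t x) - fderiv ℝ φ y (u t y)‖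
      = ‖fderiv ℝ φ x (u t x - u t y) + (fderiv ℝ φ x - fderiv ℝ φ y) (u t y)‖ := by
        rw [map_sub, sub_apply, sub_add_sub_cancel]
    _ ≤ K * (L * ‖x - y‖) + K * ‖x - y‖ * L := (norm_add_le _ _).trans <| add_le_add
        ((fderiv ℝ φ x).le_of_opNorm_le_of_le (hφ.norm_fderiv_le x) (hu.norm_sub_le t x y))
        ((fderiv ℝ φ x - fderiv ℝ φ y).le_of_opNorm_le_of_le (hφ.norm_fderiv_sub_le x y)
          (hu.bound t y))
    _ = 2 * K * L * ‖x - y‖ := by ring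

theorem norm_fderiv_fderiv_apply_le (hφ : IsTest φ K R) (hu : RegField u L) (t : ℝ) (x : Plane) :
    ‖fderiv ℝ (fun y => fderiv ℝ φ y (u t y)) x‖ ≤ 2 * K * L := by
  have hK := hφ.nonneg
  refine norm_fderiv_le_of_lipschitz (C := ⟨2 * K * L, by positivity⟩) ℝ
    (LipschitzWith.of_dist_le_mul fun y z => ?_)
  rw [dist_eq_norm, dist_eq_norm]
  exact hφ.norm_fderiv_apply_sub_le hu t y z

end IsTest

namespace IsLinearSolution

theorem abs_generator_sub_le (hθ : IsLinearSolution u θ T M) (hu : RegField u L)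
    (hφ : IsTest φ K R) {s t : ℝ} (hs : s ∈ Icc 0 T) (ht : t ∈ Icc 0 T) :
    |sintegral (θ t) (fun x => fderiv ℝ φ x (u t x))
        - sintegral (θ s) (fun x => fderiv ℝ φ x (u s x))|
      ≤ (L + 2 * L ^ 2) * M * K * |t - s| := by
  have hfield : |sintegral (θ t) (fun x => fderiv ℝ φ x (u t x))
      - sintegral (θ t) (fun x => fderiv ℝ φ x (u s x))| ≤ K * (L * |t - s|) * M := by
    refine norm_sintegral_sub_le (hφ.integrable_fderiv_apply hu t _)
      (hφ.integrable_fderiv_apply hu s _) (fun x => ?_) (hθ.bound t ht)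
    rw [← map_sub]
    exact (fderiv ℝ φ x).le_of_opNorm_le_of_le (hφ.norm_fderiv_le x) (hu.time_lip t s x)
  have hmeasure := hθ.abs_sub_le_of_hasCompactSupport (fun r _ => hu.bound r)
    ((hφ.smooth.fderiv_right (m := ∞) (by simp)).clm_apply (hu.smooth s))
    ((hφ.hasCompactSupport.fderiv ℝ).mono' fun x hx => subset_tsupport _ fun hzero =>
      hx (by simp only [hzero, zero_apply]))
    (hφ.norm_fderiv_fderiv_apply_le hu s) hs ht
  calc _ ≤ _ := _root_.abs_sub_le _ (sintegral (θ t) fun x => fderiv ℝ φ x (u s x)) _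
    _ ≤ K * (L * |t - s|) * M + 2 * K * L * L * M * |t - s| := add_le_add hfield hmeasure
    _ = (L + 2 * L ^ 2) * M * K * |t - s| := by ring

theorem abs_sub_sub_generator_le (hθ : IsLinearSolution u θ T M) (hu : RegField u L)
    (hφ : IsTest φ K R) {s h : ℝ} (hs : 0 ≤ s) (hh : 0 ≤ h) (hT : s + h ≤ T) :
    |sintegral (θ (s + h)) φ - sintegral (θ s) φ
        - h * sintegral (θ s) (fun x => fderiv ℝ φ x (u s x))|
      ≤ (L + 2 * L ^ 2) * M * K * h ^ 2 := by
  have hs' : s ∈ Icc 0 T := ⟨hs, by linarith⟩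
  have hsh : s + h ∈ Icc 0 T := ⟨by linarith, hT⟩
  have hM : 0 ≤ M := measureReal_nonneg.trans (hθ.bound s hs')
  have hK := hφ.nonneg
  have hconst : h * sintegral (θ s) (fun x => fderiv ℝ φ x (u s x))
      = ∫ _ in s..(s + h), sintegral (θ s) fun x => fderiv ℝ φ x (u s x) := by
    rw [intervalIntegral.integral_const, add_sub_cancel_left, smul_eq_mul]
  rw [hθ.weak_eq φ hφ.smooth hφ.hasCompactSupport s hs' _ hsh, hconst,
    ← intervalIntegral.integral_sub (hθ.integrable φ hφ.smooth hφ.hasCompactSupport s hs' _ hsh)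
      intervalIntegrable_const]
  have hbound := intervalIntegral.norm_integral_le_of_norm_le_const (a := s) (b := s + h)
    (f := fun r => sintegral (θ r) (fun x => fderiv ℝ φ x (u r x))
      - sintegral (θ s) fun x => fderiv ℝ φ x (u s x)) (C := (L + 2 * L ^ 2) * M * K * h)
    fun r hr => by
      rw [uIoc_of_le (by linarith)] at hr
      refine (hθ.abs_generator_sub_le hu hφ hs' ⟨by linarith [hr.1], by linarith [hr.2]⟩).trans ?_
      gcongr
      rw [abs_of_pos (by linarith [hr.1])]
      linarith [hr.2]
  refine hbound.trans_eq ?_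
  rw [add_sub_cancel_left, abs_of_nonneg hh]
  ring

end IsLinearSolution

theorem abs_sintegral_euler_step_sub_le (hu : RegField u L) (hφ : IsTest φ K R)
    {μ : SignedMeasure Plane} (hM : μ.totalVariation.real univ ≤ M) {h : ℝ} (hh : 0 ≤ h) (s : ℝ) :
    |sintegral μ (fun x => φ (x + h • u s x)) - sintegral μ φ
        - h * sintegral μ (fun x => fderiv ℝ φ x (u s x))| ≤ L ^ 2 * M * K * h ^ 2 := by
  obtain ⟨C, hC⟩ := hφ.hasCompactSupport.exists_bound_of_continuous hφ.smooth.continuous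
  have hstep : Integrable (fun x => φ (x + h • u s x)) μ.totalVariation :=
    integrable_of_continuous_of_norm_le (hφ.smooth.continuous.comp
      (continuous_id.add ((hu.smooth s).continuous.const_smul h))) fun x => hC _
  have hφi : Integrable φ μ.totalVariation :=
    integrable_of_continuous_of_norm_le hφ.smooth.continuous hC
  rw [← sintegral_sub hstep hφi, ← smul_eq_mul h, ← sintegral_smul]
  refine (norm_sintegral_sub_le (C := K * (h * L) ^ 2) (hstep.sub hφi)
    ((hφ.integrable_fderiv_apply hu s μ).smul h) (fun x => ?_) hM).trans_eq (by ring)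
  have htaylor := hφ.abs_taylor_le x (h • u s x)
  rw [map_smul] at htaylor
  have hK := hφ.nonneg
  exact htaylor.trans (by gcongr; exact hu.norm_smul_le hh s x)

theorem IsLinearSolution.isConsistent (hθ : IsLinearSolution u θ T M) (hu : RegField u L) :
    IsConsistent u T fun t => sintegral (θ t) := by
  refine fun R => ⟨(L + 3 * L ^ 2) * M, fun φ K s h hφ hs hh hT => ?_⟩
  have hsol := hθ.abs_sub_sub_generator_le hu hφ hs hh hT
  have hstep := abs_sintegral_euler_step_sub_le hu hφ (hθ.bound s ⟨hs, by linarith⟩) hh s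
  change |sintegral (θ (s + h)) φ - sintegral (θ s) (fun x => φ (x + h • u s x))| ≤ _
  calc _ = |(sintegral (θ (s + h)) φ - sintegral (θ s) φ
          - h * sintegral (θ s) (fun x => fderiv ℝ φ x (u s x)))
        - (sintegral (θ s) (fun x => φ (x + h • u s x)) - sintegral (θ s) φ
          - h * sintegral (θ s) (fun x => fderiv ℝ φ x (u s x)))| := by
        congr 1; ring
    _ ≤ (L + 2 * L ^ 2) * M * K * h ^ 2 + L ^ 2 * M * K * h ^ 2 :=
        (abs_sub _ _).trans (add_le_add hsol hstep)
    _ = (L + 3 * L ^ 2) * M * K * h ^ 2 := by ring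

theorem IsFlow.isConsistent_sintegral (hX : IsFlow u X) (hu : RegField u L)
    (μ : SignedMeasure Plane) :
    IsConsistent u T fun t φ => sintegral μ fun x => φ (X t x) := by
  refine fun R => ⟨(L + L * L) * μ.totalVariation.real univ,
    fun φ K s h hφ _ hh _ => ?_⟩
  obtain ⟨C, hC⟩ := hφ.hasCompactSupport.exists_bound_of_continuous hφ.smooth.continuous
  have hXs := hX.continuous_space hu s
  refine (norm_sintegral_sub_le (integrable_of_continuous_of_norm_le (hφ.smooth.continuous.comp
      (hX.continuous_space hu _)) fun x => hC _)
    (integrable_of_continuous_of_norm_le (hφ.smooth.continuous.comp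
      (hXs.add (((hu.smooth s).continuous.comp hXs).const_smul h))) fun x => hC _)
    (hX.abs_comp_sub_le hu hφ hh) le_rfl).trans_eq (by ring)

theorem IsLinearSolution.eq_push (hθ : IsLinearSolution u θ T M) (hu : RegField u L)
    (hX : IsFlow u X) {t : ℝ} (ht : t ∈ Icc 0 T) : θ t = push (X t) (θ 0) := by
  refine signedMeasure_ext_of_sintegral_contDiff fun φ hφ hc => ?_
  obtain ⟨K, R, hφ⟩ := exists_isTest hφ hc
  rw [sintegral_push (hX.measurableEmbedding hu t)]
  exact (hθ.isConsistent hu).eq_of_isTest (hX.isConsistent_sintegral hu (θ 0)) hu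
    (fun φ => by simp only [hX.zero]) hφ ht

theorem IsSolution.exists_flow (hk : SmoothBdd k) (h : IsSolution k θ₀ θ) (hT : 0 ≤ T) :
    ∃ (u : ℝ → Plane → Plane) (L : ℝ≥0) (X : ℝ → Plane → Plane), RegField u L ∧ IsFlow u X ∧
      (∀ t, ∃ s ∈ Icc 0 T, u t = velocity k (θ s)) ∧ (∀ t ∈ Icc 0 T, u t = velocity k (θ t)) ∧
      ∀ t ∈ Icc 0 T, θ t = push (X t) θ₀ := by
  obtain ⟨M, hM⟩ := h.locally_bounded T
  have hM_real (t : ℝ) (ht : t ∈ Icc 0 T) : (θ t).totalVariation.real univ ≤ M :=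
    ENNReal.toReal_le_of_le_ofReal M.2 (by simpa using hM t ht)
  obtain ⟨L, hL⟩ := h.exists_regField hk hT hM_real
  obtain ⟨X, hX⟩ := hL.exists_isFlow
  have heq (t : ℝ) (ht : t ∈ Icc 0 T) : velocity k (θ (projIcc 0 T hT t)) = velocity k (θ t) := by
    rw [projIcc_of_mem hT ht]
  refine ⟨_, L, X, hL, hX, fun t => ⟨_, (projIcc 0 T hT t).2, rfl⟩, heq, fun t ht => ?_⟩
  rw [← h.zero]
  exact ((h.isLinearSolution hM_real).congr fun t ht => (heq t ht).symm).eq_push hL hX ht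

end Duality

section Wasserstein

theorem min_one_add_le {a b : ℝ} (ha : 0 ≤ a) (hb : 0 ≤ b) :
    min 1 (a + b) ≤ min 1 a + min 1 b := by
  rw [← min_add_add_left, le_min_iff, ← min_add_add_right, ← min_add_add_right]
  exact ⟨le_min ((min_le_left _ _).trans (by linarith)) ((min_le_left _ _).trans (by linarith)),
    le_min ((min_le_left _ _).trans (by linarith)) (min_le_right _ _)⟩

theorem norm_min_one_norm_le (x : Plane) : ‖min 1 ‖x‖‖ ≤ 1 := by
  rw [Real.norm_of_nonneg (by positivity)]
  exact min_le_left _ _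

theorem integrable_min_one_norm_sub {α : Type*} [TopologicalSpace α] [MeasurableSpace α]
    [OpensMeasurableSpace α] [SecondCountableTopology α] (π : Measure α) [IsFiniteMeasure π]
    {f g : α → Plane} (hf : Continuous f) (hg : Continuous g) :
    Integrable (fun a => min 1 ‖f a - g a‖) π :=
  integrable_of_continuous_of_norm_le (continuous_const.min (hf.sub hg).norm) fun _ =>
    norm_min_one_norm_le _

theorem lintegral_ofReal_min_one_norm_sub {α : Type*} [TopologicalSpace α] [MeasurableSpace α]
    [OpensMeasurableSpace α] [SecondCountableTopology α] (π : Measure α) [IsFiniteMeasure π]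
    {f g : α → Plane} (hf : Continuous f) (hg : Continuous g) :
    ∫⁻ a, ENNReal.ofReal (min 1 ‖f a - g a‖) ∂π = ENNReal.ofReal (∫ a, min 1 ‖f a - g a‖ ∂π) :=
  (ofReal_integral_eq_lintegral_ofReal (integrable_min_one_norm_sub π hf hg)
    (Eventually.of_forall fun a => by positivity)).symm

theorem wass_map_map_le {α : Type*} [MeasurableSpace α] (π : Measure α) {f g : α → Plane}
    (hf : Measurable f) (hg : Measurable g) :
    wass (π.map f) (π.map g) ≤ ∫⁻ a, ENNReal.ofReal (min 1 ‖f a - g a‖) ∂π := by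
  have hfg : Measurable fun a => (f a, g a) := hf.prodMk hg
  have hcost : Measurable fun z : Plane × Plane => ENNReal.ofReal (min 1 ‖z.1 - z.2‖) := by
    fun_prop
  refine (iInf₂_le (π.map fun a => (f a, g a)) ⟨?_, ?_⟩).trans_eq (lintegral_map hcost hfg)
  · exact Measure.map_map measurable_fst hfg
  · exact Measure.map_map measurable_snd hfg

theorem wass_self (μ : Measure Plane) : wass μ μ = 0 := by
  simpa using wass_map_map_le μ measurable_id measurable_id

theorem signedWass_self (μ : SignedMeasure Plane) : signedWass μ μ = 0 := by
  rw [signedWass, wass_self, wass_self, add_zero]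

variable {F : Type*} [NormedAddCommGroup F] [NormedSpace ℝ F]

theorem norm_integral_map_fst_sub_map_snd_le {α β : Type*} [MeasurableSpace α]
    [MeasurableSpace β] {π : Measure (α × β)} {f : α → F} {g : β → F}
    (hf : Integrable f (π.map Prod.fst)) (hg : Integrable g (π.map Prod.snd))
    {b : α × β → ℝ} (hb : Integrable b π) (hfg : ∀ p, ‖f p.1 - g p.2‖ ≤ b p) :
    ‖∫ x, f x ∂π.map Prod.fst - ∫ y, g y ∂π.map Prod.snd‖ ≤ ∫ p, b p ∂π := by
  have hf' : Integrable (fun p : α × β => f p.1) π := hf.comp_measurable measurable_fst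
  have hg' : Integrable (fun p : α × β => g p.2) π := hg.comp_measurable measurable_snd
  rw [integral_map measurable_fst.aemeasurable hf.aestronglyMeasurable,
    integral_map measurable_snd.aemeasurable hg.aestronglyMeasurable, ← integral_sub hf' hg']
  exact norm_integral_le_of_norm_le hb (Eventually.of_forall hfg)

theorem enorm_integral_sub_le_mul_wass {μ ν : Measure Plane} [IsFiniteMeasure μ]
    {f : Plane → F} (hf : Continuous f) {C : ℝ≥0} (hC₀ : C ≠ 0)
    (hC : ∀ x y, ‖f x - f y‖ ≤ C * min 1 ‖x - y‖) :
    ‖∫ x, f x ∂μ - ∫ x, f x ∂ν‖ₑ ≤ C * wass μ ν := by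
  have hC₀' : (C : ℝ≥0∞) ≠ 0 := ENNReal.coe_ne_zero.2 hC₀
  have hint (ξ : Measure Plane) [IsFiniteMeasure ξ] : Integrable f ξ :=
    integrable_of_continuous_of_norm_le (C := C + ‖f 0‖) hf fun x =>
      (norm_le_norm_sub_add _ (f 0)).trans (add_le_add_left
        ((hC x 0).trans (mul_le_of_le_one_right C.2 (min_le_left _ _))) _)
  rw [mul_comm, ← ENNReal.div_le_iff hC₀' ENNReal.coe_ne_top, wass]
  refine le_iInf₂ fun π hπ => ?_
  rw [ENNReal.div_le_iff hC₀' ENNReal.coe_ne_top, mul_comm]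
  have hπ_fin : IsFiniteMeasure (π.map Prod.fst) := hπ.1 ▸ inferInstance
  have := Measure.isFiniteMeasure_of_map measurable_fst.aemeasurable (μ := π)
  have hcost := integrable_min_one_norm_sub π continuous_fst continuous_snd
  rw [← hπ.1, ← hπ.2, ← ofReal_norm,
    lintegral_ofReal_min_one_norm_sub π continuous_fst continuous_snd, ← ENNReal.ofReal_coe_nnreal,
    ← ENNReal.ofReal_mul C.coe_nonneg, ← integral_const_mul]
  exact ENNReal.ofReal_le_ofReal (norm_integral_map_fst_sub_map_snd_le (hint _)
    (hint _) (hcost.const_mul _) fun p => hC _ _)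

theorem exists_norm_sub_le_mul_min_one {f : Plane → F} (hf : ContDiff ℝ ∞ f)
    (hc : HasCompactSupport f) :
    ∃ C : ℝ≥0, C ≠ 0 ∧ ∀ x y, ‖f x - f y‖ ≤ C * min 1 ‖x - y‖ := by
  obtain ⟨A, hA⟩ := hc.exists_bound_of_continuous hf.continuous
  obtain ⟨B, hB⟩ := exists_norm_fderiv_le hf hc
  have hA₀ : 0 ≤ A := (norm_nonneg _).trans (hA 0)
  have hB₀ : 0 ≤ B := (norm_nonneg _).trans (hB 0)
  refine ⟨⟨A + A + B + 1, by positivity⟩, fun h => ?_, fun x y => ?_⟩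
  · have hsum : A + A + B + 1 = 0 := congrArg NNReal.toReal h
    linarith
  · change _ ≤ (A + A + B + 1) * _
    rw [mul_min_of_nonneg _ _ (by positivity), le_min_iff]
    constructor
    · linarith [norm_sub_le (f x) (f y), hA x, hA y]
    · refine (convex_univ.norm_image_sub_le_of_norm_fderiv_le (𝕜 := ℝ)
        (fun z _ => hf.differentiable (by simp) z) (fun z _ => hB z) (mem_univ y)
        (mem_univ x)).trans ?_
      gcongr
      linarith

theorem eq_of_wass_eq_zero {μ ν : Measure Plane} [IsFiniteMeasure μ] [IsFiniteMeasure ν]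
    (h : wass μ ν = 0) : μ = ν := by
  refine measure_ext_of_integral_contDiff fun φ hφ hc => ?_
  obtain ⟨C, hC₀, hC⟩ := exists_norm_sub_le_mul_min_one hφ hc
  have hle := enorm_integral_sub_le_mul_wass (μ := μ) (ν := ν) hφ.continuous hC₀ hC
  rwa [h, mul_zero, nonpos_iff_eq_zero, enorm_eq_zero, sub_eq_zero] at hle

theorem eq_of_signedWass_eq_zero {μ ν : SignedMeasure Plane} (h : signedWass μ ν = 0) :
    μ = ν := by
  rw [signedWass, add_eq_zero] at h
  rw [← μ.toSignedMeasure_toJordanDecomposition, ← ν.toSignedMeasure_toJordanDecomposition,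
    JordanDecomposition.ext (eq_of_wass_eq_zero h.1) (eq_of_wass_eq_zero h.2)]

/-- `π₁` couples the positive parts of `μ` and `ν`, and `π₂` their negative parts. -/
structure IsSignedCoupling (π₁ π₂ : Measure (Plane × Plane)) (μ ν : SignedMeasure Plane) :
    Prop where
  map_fst_pos : π₁.map Prod.fst = μ.toJordanDecomposition.posPart
  map_snd_pos : π₁.map Prod.snd = ν.toJordanDecomposition.posPart
  map_fst_neg : π₂.map Prod.fst = μ.toJordanDecomposition.negPart
  map_snd_neg : π₂.map Prod.snd = ν.toJordanDecomposition.negPart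

namespace IsSignedCoupling

variable {π₁ π₂ : Measure (Plane × Plane)} {μ ν : SignedMeasure Plane}

theorem map_fst_add (h : IsSignedCoupling π₁ π₂ μ ν) :
    (π₁ + π₂).map Prod.fst = μ.totalVariation := by
  rw [Measure.map_add _ _ measurable_fst, h.map_fst_pos, h.map_fst_neg,
    SignedMeasure.totalVariation]

theorem measureReal_univ (h : IsSignedCoupling π₁ π₂ μ ν) :
    (π₁ + π₂).real univ = μ.totalVariation.real univ := by
  rw [← h.map_fst_add, map_measureReal_apply measurable_fst .univ, preimage_univ]

theorem isFiniteMeasure (h : IsSignedCoupling π₁ π₂ μ ν) : IsFiniteMeasure (π₁ + π₂) :=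
  have : IsFiniteMeasure ((π₁ + π₂).map Prod.fst) := h.map_fst_add ▸ inferInstance
  Measure.isFiniteMeasure_of_map measurable_fst.aemeasurable

theorem norm_sintegral_sub_le (h : IsSignedCoupling π₁ π₂ μ ν) {f g : Plane → F}
    (hf : Integrable f μ.totalVariation) (hg : Integrable g ν.totalVariation)
    {b : Plane × Plane → ℝ} (hb : Integrable b (π₁ + π₂))
    (hfg : ∀ p : Plane × Plane, ‖f p.1 - g p.2‖ ≤ b p) :
    ‖sintegral μ f - sintegral ν g‖ ≤ ∫ p, b p ∂(π₁ + π₂) := by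
  rw [integrable_totalVariation_iff, ← h.map_fst_pos, ← h.map_fst_neg] at hf
  rw [integrable_totalVariation_iff, ← h.map_snd_pos, ← h.map_snd_neg] at hg
  rw [integrable_add_measure] at hb
  rw [sintegral, sintegral, ← h.map_fst_pos, ← h.map_fst_neg, ← h.map_snd_pos, ← h.map_snd_neg,
    sub_sub_sub_comm, integral_add_measure hb.1 hb.2]
  exact (norm_sub_le _ _).trans (add_le_add
    (norm_integral_map_fst_sub_map_snd_le hf.1 hg.1 hb.1 hfg)
    (norm_integral_map_fst_sub_map_snd_le hf.2 hg.2 hb.2 hfg))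

end IsSignedCoupling

end Wasserstein

section Gronwall

theorem le_mul_exp_of_le_add_integral {h : ℝ → ℝ} (hc : Continuous h) {K T : ℝ} (hK : 0 ≤ K)
    (hle : ∀ t ∈ Icc 0 T, h t ≤ h 0 + K * ∫ s in (0 : ℝ)..t, h s) {t : ℝ} (ht : t ∈ Icc 0 T) :
    h t ≤ h 0 * Real.exp (K * t) := by
  let g (t : ℝ) : ℝ := h 0 + K * ∫ s in (0 : ℝ)..t, h s
  have hg (t : ℝ) : HasDerivAt g (K * h t) t :=
    ((hc.integral_hasStrictDerivAt 0 t).hasDerivAt.const_mul K).const_add (h 0)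
  have hgronwall := le_gronwallBound_of_liminf_deriv_right_le (f := g) (f' := fun t => K * h t)
    (δ := h 0) (K := K) (ε := 0) (a := 0) (b := T)
    (fun s _ => (hg s).continuousAt.continuousWithinAt)
    (fun s _ r hr => (hg s).hasDerivWithinAt.liminf_right_slope_le hr)
    (by simp [g]) (fun s hs => by
      rw [add_zero]
      exact mul_le_mul_of_nonneg_left (hle s (Ico_subset_Icc_self hs)) hK) t ht
  rw [gronwallBound_ε0, sub_zero] at hgronwall
  exact (hle t ht).trans hgronwall

section MeanField

variable {α : Type*} [MeasurableSpace α] {π : Measure α} [IsFiniteMeasure π]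

theorem integral_mul_add_integral {f : α → ℝ} (hf : Integrable f π) (c : ℝ) :
    ∫ p, c * (π.real univ * f p + ∫ q, f q ∂π) ∂π = 2 * c * π.real univ * ∫ p, f p ∂π := by
  rw [integral_const_mul, integral_add (hf.const_mul _) (integrable_const _),
    integral_const_mul, integral_const, smul_eq_mul]
  ring

variable [TopologicalSpace α] [OpensMeasurableSpace α]

section Parametric

variable {τ G : Type*} [TopologicalSpace τ] [NormedAddCommGroup G] {B : ℝ}

theorem continuous_integral_of_norm_le [FirstCountableTopology τ]
    [SecondCountableTopologyEither α G] [NormedSpace ℝ G] {d : τ → α → G}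
    (hd : Continuous fun q : τ × α => d q.1 q.2) (hB : ∀ t p, ‖d t p‖ ≤ B) :
    Continuous fun t => ∫ p, d t p ∂π :=
  continuous_of_dominated
    (fun t => (hd.comp (Continuous.prodMk_right t)).aestronglyMeasurable)
    (fun t => Eventually.of_forall (hB t)) (integrable_const B)
    (Eventually.of_forall fun p => hd.comp (Continuous.prodMk_left p))

theorem integrable_uncurry_of_norm_le [SecondCountableTopology α] {d : ℝ → α → G}
    (hd : Continuous fun q : ℝ × α => d q.1 q.2) (hB : ∀ t p, ‖d t p‖ ≤ B) (s t : ℝ) :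
    Integrable (Function.uncurry d) ((volume.restrict (uIoc s t)).prod π) :=
  have : Fact (volume (uIoc s t) < ⊤) := ⟨measure_Ioc_lt_top⟩
  integrable_of_continuous_of_norm_le hd fun q => hB q.1 q.2

end Parametric

variable {d : ℝ → α → ℝ} {B c T : ℝ}

theorem integral_le_mul_exp_of_le_add_integral [SecondCountableTopology α] (hc : 0 ≤ c)
    (hd : Continuous fun q : ℝ × α => d q.1 q.2) (hB : ∀ t p, ‖d t p‖ ≤ B)
    (hle : ∀ t ∈ Icc 0 T, ∀ p,
      d t p ≤ d 0 p + ∫ s in (0 : ℝ)..t, c * (π.real univ * d s p + ∫ q, d s q ∂π))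
    {t : ℝ} (ht : t ∈ Icc 0 T) :
    ∫ p, d t p ∂π ≤ (∫ p, d 0 p ∂π) * Real.exp (2 * c * π.real univ * t) := by
  have hint (t : ℝ) : Integrable (d t) π :=
    integrable_of_continuous_of_norm_le (hd.comp (Continuous.prodMk_right t)) (hB t)
  have hmean : Continuous fun t => ∫ p, d t p ∂π := continuous_integral_of_norm_le hd hB
  refine le_mul_exp_of_le_add_integral hmean (by positivity) (fun s hs => ?_) ht
  have hbound (r : ℝ) (p : α) : ‖c * (π.real univ * d r p + ∫ q, d r q ∂π)‖
      ≤ c * (π.real univ * B + B * π.real univ) := by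
    rw [norm_mul, Real.norm_of_nonneg hc]
    gcongr
    refine norm_add_le_of_le ?_ (norm_integral_le_of_norm_le_const (Eventually.of_forall (hB r)))
    rw [norm_mul, Real.norm_of_nonneg measureReal_nonneg]
    gcongr
    exact hB r p
  have hrate := integrable_uncurry_of_norm_le (π := π)
    (d := fun r p => c * (π.real univ * d r p + ∫ q, d r q ∂π))
    (continuous_const.mul ((continuous_const.mul hd).add (hmean.comp continuous_fst))) hbound 0 s
  have hrate_int : Integrable
      (fun p => ∫ r in (0 : ℝ)..s, c * (π.real univ * d r p + ∫ q, d r q ∂π)) π := by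
    simp only [intervalIntegral.integral_of_le hs.1]
    rw [← uIoc_of_le hs.1]
    exact hrate.integral_prod_right
  calc ∫ p, d s p ∂π
      ≤ ∫ p, (d 0 p + ∫ r in (0 : ℝ)..s, c * (π.real univ * d r p + ∫ q, d r q ∂π)) ∂π :=
        integral_mono (hint s) ((hint 0).add hrate_int) (hle s hs)
    _ = ∫ p, d 0 p ∂π + 2 * c * π.real univ * ∫ r in (0 : ℝ)..s, ∫ p, d r p ∂π := by
        rw [integral_add (hint 0) hrate_int, ← intervalIntegral_integral_swap hrate]
        simp only [integral_mul_add_integral (hint _), intervalIntegral.integral_const_mul]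

end MeanField

theorem IsFlow.norm_sub_le_add_integral {E : Type*} [NormedAddCommGroup E] [NormedSpace ℝ E]
    {u v : ℝ → E → E} {X Y : ℝ → E → E} (hX : IsFlow u X) (hY : IsFlow v Y) {g : ℝ → ℝ} {T : ℝ}
    (hg : Continuous g) {x y : E} (hle : ∀ t ∈ Ico 0 T, ‖u t (X t x) - v t (Y t y)‖ ≤ g t)
    {t : ℝ} (ht : t ∈ Icc 0 T) : ‖X t x - Y t y‖ ≤ ‖x - y‖ + ∫ s in (0 : ℝ)..t, g s := by
  have hderiv (s : ℝ) :
      HasDerivAt (fun s => X s x - Y s y) (u s (X s x) - v s (Y s y)) s :=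
    (hX.isIntegralCurve x s).sub (hY.isIntegralCurve y s)
  exact image_norm_le_of_norm_deriv_right_le_deriv_boundary
    (f' := fun s => u s (X s x) - v s (Y s y))
    (B := fun t => ‖x - y‖ + ∫ s in (0 : ℝ)..t, g s)
    (fun s _ => (hderiv s).continuousAt.continuousWithinAt) (fun s _ => (hderiv s).hasDerivWithinAt)
    (by simp [hX.zero, hY.zero])
    (fun s => (hg.integral_hasStrictDerivAt 0 s).hasDerivAt.const_add _) hle ht

end Gronwall

section Stability

variable {k : Plane → Plane} {π₁ π₂ : Measure (Plane × Plane)} {μ ν θ₀₁ θ₀₂ : SignedMeasure Plane}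
  {θ₁ θ₂ : ℝ → SignedMeasure Plane} {u₁ u₂ X₁ X₂ : ℝ → Plane → Plane} {L₁ L₂ : ℝ≥0} {T : ℝ}

theorem le_mul_signedWass {a b : ℝ≥0∞} (hb₀ : b ≠ 0) (hb : b ≠ ⊤)
    (h : ∀ π₁ π₂, IsSignedCoupling π₁ π₂ μ ν →
      a ≤ b * ∫⁻ p, ENNReal.ofReal (min 1 ‖p.1 - p.2‖) ∂(π₁ + π₂)) :
    a ≤ b * signedWass μ ν := by
  rw [mul_comm, ← ENNReal.div_le_iff hb₀ hb, signedWass, wass, wass]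
  simp only [ENNReal.iInf_add, ENNReal.add_iInf]
  refine le_iInf₂ fun π₂ hπ₂ => le_iInf₂ fun π₁ hπ₁ => ?_
  rw [ENNReal.div_le_iff hb₀ hb, mul_comm, ← lintegral_add_measure]
  exact h π₁ π₂ ⟨hπ₁.1, hπ₁.2, hπ₂.1, hπ₂.2⟩

theorem IsFlow.continuous_min_one_norm_sub (hX₁ : IsFlow u₁ X₁) (hu₁ : RegField u₁ L₁)
    (hX₂ : IsFlow u₂ X₂) (hu₂ : RegField u₂ L₂) :
    Continuous fun q : ℝ × Plane × Plane => min 1 ‖X₁ q.1 q.2.1 - X₂ q.1 q.2.2‖ := by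
  have h₁ : Continuous fun q : ℝ × Plane × Plane => X₁ q.1 q.2.1 :=
    (hX₁.continuous hu₁).comp (f := fun q : ℝ × Plane × Plane => (q.1, q.2.1)) (by fun_prop)
  have h₂ : Continuous fun q : ℝ × Plane × Plane => X₂ q.1 q.2.2 :=
    (hX₂.continuous hu₂).comp (f := fun q : ℝ × Plane × Plane => (q.1, q.2.2)) (by fun_prop)
  exact continuous_const.min (h₁.sub h₂).norm

namespace IsSignedCoupling

theorem signedWass_push_le (hπ : IsSignedCoupling π₁ π₂ μ ν) {Φ₁ Φ₂ : Plane → Plane}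
    (hΦ₁ : MeasurableEmbedding Φ₁) (hΦ₂ : MeasurableEmbedding Φ₂) :
    signedWass (push Φ₁ μ) (push Φ₂ ν)
      ≤ ∫⁻ p, ENNReal.ofReal (min 1 ‖Φ₁ p.1 - Φ₂ p.2‖) ∂(π₁ + π₂) := by
  have hwass (π : Measure (Plane × Plane)) :
      wass ((π.map Prod.fst).map Φ₁) ((π.map Prod.snd).map Φ₂)
        ≤ ∫⁻ p, ENNReal.ofReal (min 1 ‖Φ₁ p.1 - Φ₂ p.2‖) ∂π := by
    rw [Measure.map_map hΦ₁.measurable measurable_fst,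
      Measure.map_map hΦ₂.measurable measurable_snd]
    exact wass_map_map_le π (hΦ₁.measurable.comp measurable_fst)
      (hΦ₂.measurable.comp measurable_snd)
  rw [signedWass, (toJordanDecomposition_push hΦ₁ μ).1, (toJordanDecomposition_push hΦ₁ μ).2,
    (toJordanDecomposition_push hΦ₂ ν).1, (toJordanDecomposition_push hΦ₂ ν).2,
    ← hπ.map_fst_pos, ← hπ.map_snd_pos, ← hπ.map_fst_neg, ← hπ.map_snd_neg, lintegral_add_measure]
  exact add_le_add (hwass π₁) (hwass π₂)

theorem norm_velocity_push_sub_le (hπ : IsSignedCoupling π₁ π₂ μ ν) (hk : SmoothBdd k)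
    {Φ₁ Φ₂ : Plane → Plane} (hΦ₁ : MeasurableEmbedding Φ₁) (hΦ₁c : Continuous Φ₁)
    (hΦ₂ : MeasurableEmbedding Φ₂) (hΦ₂c : Continuous Φ₂) (x y : Plane) :
    ‖velocity k (push Φ₁ μ) x - velocity k (push Φ₂ ν) y‖
      ≤ (kernelConst k).toNNReal * ((π₁ + π₂).real univ * min 1 ‖x - y‖
        + ∫ p, min 1 ‖Φ₁ p.1 - Φ₂ p.2‖ ∂(π₁ + π₂)) := by
  have := hπ.isFiniteMeasure
  have hcost : Integrable (fun p => min 1 ‖Φ₁ p.1 - Φ₂ p.2‖) (π₁ + π₂) :=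
    integrable_min_one_norm_sub _ (hΦ₁c.comp continuous_fst) (hΦ₂c.comp continuous_snd)
  have hint (ξ : SignedMeasure Plane) {Φ : Plane → Plane} (hΦ : Continuous Φ) (z : Plane) :
      Integrable (fun y => k (z - Φ y)) ξ.totalVariation := by
    obtain ⟨C, -, hC⟩ := hk.exists_norm_le
    exact integrable_of_continuous_of_norm_le
      (hk.smooth.continuous.comp (continuous_const.sub hΦ)) fun _ => hC _
  have hdiff (p : Plane × Plane) : ‖k (x - Φ₁ p.1) - k (y - Φ₂ p.2)‖
      ≤ (kernelConst k).toNNReal * (min 1 ‖x - y‖ + min 1 ‖Φ₁ p.1 - Φ₂ p.2‖) := by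
    refine (norm_sub_le_kernelConst hk _ _).trans ?_
    rw [sub_sub_sub_comm]
    gcongr
    exact (min_le_min_left 1 (norm_sub_le _ _)).trans
      (min_one_add_le (norm_nonneg _) (norm_nonneg _))
  rw [velocity, velocity, sintegral_push hΦ₁, sintegral_push hΦ₂]
  refine (hπ.norm_sintegral_sub_le (hint μ hΦ₁c x) (hint ν hΦ₂c y)
    (((integrable_const _).add hcost).const_mul _) hdiff).trans_eq ?_
  rw [integral_const_mul]
  congr 1
  rw [integral_add' (integrable_const _) hcost, integral_const, smul_eq_mul]

theorem min_one_norm_flow_sub_le (hπ : IsSignedCoupling π₁ π₂ μ ν) (hk : SmoothBdd k)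
    (hu₁ : RegField u₁ L₁) (hX₁ : IsFlow u₁ X₁) (hu₂ : RegField u₂ L₂) (hX₂ : IsFlow u₂ X₂)
    (hv₁ : ∀ t ∈ Icc 0 T, u₁ t = velocity k (push (X₁ t) μ))
    (hv₂ : ∀ t ∈ Icc 0 T, u₂ t = velocity k (push (X₂ t) ν)) {t : ℝ} (ht : t ∈ Icc 0 T)
    (p : Plane × Plane) :
    min 1 ‖X₁ t p.1 - X₂ t p.2‖ ≤ min 1 ‖X₁ 0 p.1 - X₂ 0 p.2‖ + ∫ s in (0 : ℝ)..t,
      (kernelConst k).toNNReal * ((π₁ + π₂).real univ * min 1 ‖X₁ s p.1 - X₂ s p.2‖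
        + ∫ q, min 1 ‖X₁ s q.1 - X₂ s q.2‖ ∂(π₁ + π₂)) := by
  have := hπ.isFiniteMeasure
  have hcont := hX₁.continuous_min_one_norm_sub hu₁ hX₂ hu₂
  have hrate : Continuous fun s : ℝ =>
      (kernelConst k).toNNReal * ((π₁ + π₂).real univ * min 1 ‖X₁ s p.1 - X₂ s p.2‖
        + ∫ q, min 1 ‖X₁ s q.1 - X₂ s q.2‖ ∂(π₁ + π₂)) :=
    continuous_const.mul ((continuous_const.mul (hcont.comp (Continuous.prodMk_left p))).add
      (continuous_integral_of_norm_le hcont fun _ _ => norm_min_one_norm_le _))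
  have hrate_nonneg : 0 ≤ ∫ s in (0 : ℝ)..t,
      (kernelConst k).toNNReal * ((π₁ + π₂).real univ * min 1 ‖X₁ s p.1 - X₂ s p.2‖
        + ∫ q, min 1 ‖X₁ s q.1 - X₂ s q.2‖ ∂(π₁ + π₂)) :=
    intervalIntegral.integral_nonneg ht.1 fun s _ => by positivity
  have hnorm := hX₁.norm_sub_le_add_integral hX₂ hrate (x := p.1) (y := p.2) (fun s hs => by
    rw [hv₁ s (Ico_subset_Icc_self hs), hv₂ s (Ico_subset_Icc_self hs)]
    exact hπ.norm_velocity_push_sub_le hk (hX₁.measurableEmbedding hu₁ s)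
      (hX₁.continuous_space hu₁ s) (hX₂.measurableEmbedding hu₂ s) (hX₂.continuous_space hu₂ s)
      (X₁ s p.1) (X₂ s p.2)) ht
  rw [hX₁.zero, hX₂.zero]
  exact (min_le_min_left 1 hnorm).trans ((min_one_add_le (norm_nonneg _) hrate_nonneg).trans
    (add_le_add_right (min_le_right _ _) _))

theorem integral_min_one_norm_flow_sub_le (hπ : IsSignedCoupling π₁ π₂ μ ν) (hk : SmoothBdd k)
    (hu₁ : RegField u₁ L₁) (hX₁ : IsFlow u₁ X₁) (hu₂ : RegField u₂ L₂) (hX₂ : IsFlow u₂ X₂)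
    (hv₁ : ∀ t ∈ Icc 0 T, u₁ t = velocity k (push (X₁ t) μ))
    (hv₂ : ∀ t ∈ Icc 0 T, u₂ t = velocity k (push (X₂ t) ν)) {t : ℝ} (ht : t ∈ Icc 0 T) :
    ∫ p, min 1 ‖X₁ t p.1 - X₂ t p.2‖ ∂(π₁ + π₂) ≤ (∫ p, min 1 ‖p.1 - p.2‖ ∂(π₁ + π₂))
      * Real.exp (2 * (kernelConst k).toNNReal * (π₁ + π₂).real univ * t) := by
  have := hπ.isFiniteMeasure
  have hle := integral_le_mul_exp_of_le_add_integral (kernelConst k).toNNReal.coe_nonneg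
    (hX₁.continuous_min_one_norm_sub hu₁ hX₂ hu₂) (fun _ _ => norm_min_one_norm_le _)
    (fun _ => hπ.min_one_norm_flow_sub_le hk hu₁ hX₁ hu₂ hX₂ hv₁ hv₂) ht
  simpa only [hX₁.zero, hX₂.zero] using hle

end IsSignedCoupling

theorem signedWass_le (hk : SmoothBdd k) (h₁ : IsSolution k θ₀₁ θ₁) (h₂ : IsSolution k θ₀₂ θ₂)
    {M : ℝ} (hM : θ₀₁.totalVariation.real univ ≤ M) {t : ℝ} (ht : t ∈ Icc 0 T) :
    signedWass (θ₁ t) (θ₂ t) ≤ ENNReal.ofReal (Real.exp (2 * (kernelConst k).toNNReal * M * T))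
      * signedWass θ₀₁ θ₀₂ := by
  have hT : 0 ≤ T := ht.1.trans ht.2
  obtain ⟨u₁, L₁, X₁, hu₁, hX₁, -, hv₁, hpush₁⟩ := h₁.exists_flow hk hT
  obtain ⟨u₂, L₂, X₂, hu₂, hX₂, -, hv₂, hpush₂⟩ := h₂.exists_flow hk hT
  refine le_mul_signedWass (ENNReal.ofReal_pos.2 (Real.exp_pos _)).ne'
    ENNReal.ofReal_ne_top fun π₁ π₂ hπ => ?_
  have := hπ.isFiniteMeasure
  have hgronwall := hπ.integral_min_one_norm_flow_sub_le hk hu₁ hX₁ hu₂ hX₂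
    (fun s hs => by rw [hv₁ s hs, hpush₁ s hs]) (fun s hs => by rw [hv₂ s hs, hpush₂ s hs]) ht
  have hexp : Real.exp (2 * (kernelConst k).toNNReal * (π₁ + π₂).real univ * t)
      ≤ Real.exp (2 * (kernelConst k).toNNReal * M * T) := by
    have hM₀ : 0 ≤ M := measureReal_nonneg.trans hM
    rw [hπ.measureReal_univ]
    gcongr
    · exact ht.1
    · exact ht.2
  calc signedWass (θ₁ t) (θ₂ t)
      ≤ ENNReal.ofReal (∫ p, min 1 ‖X₁ t p.1 - X₂ t p.2‖ ∂(π₁ + π₂)) := by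
        rw [hpush₁ t ht, hpush₂ t ht]
        exact (hπ.signedWass_push_le (hX₁.measurableEmbedding hu₁ t)
          (hX₂.measurableEmbedding hu₂ t)).trans_eq (lintegral_ofReal_min_one_norm_sub _
            ((hX₁.continuous_space hu₁ t).comp continuous_fst)
            ((hX₂.continuous_space hu₂ t).comp continuous_snd))
    _ ≤ ENNReal.ofReal (Real.exp (2 * (kernelConst k).toNNReal * M * T)
          * ∫ p, min 1 ‖p.1 - p.2‖ ∂(π₁ + π₂)) := by
        rw [mul_comm]
        exact ENNReal.ofReal_le_ofReal (hgronwall.trans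
          (mul_le_mul_of_nonneg_left hexp (integral_nonneg fun p => by positivity)))
    _ = _ := by
        rw [ENNReal.ofReal_mul (Real.exp_pos _).le,
          lintegral_ofReal_min_one_norm_sub _ continuous_fst continuous_snd]

theorem IsSolution.unique (hk : SmoothBdd k) (h₁ : IsSolution k μ θ₁) (h₂ : IsSolution k μ θ₂)
    {t : ℝ} (ht : 0 ≤ t) : θ₁ t = θ₂ t := by
  have hle := signedWass_le hk h₁ h₂ le_rfl (right_mem_Icc.2 ht)
  rw [signedWass_self, mul_zero] at hle
  exact eq_of_signedWass_eq_zero (nonpos_iff_eq_zero.1 hle)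

end Stability

section Density

theorem exists_push_withDensity {α : Type*} [MeasurableSpace α] {μ : Measure α} {Φ : α → α}
    (hΦ : MeasurableEmbedding Φ) (hμ : MeasurePreserving Φ μ μ) {f₀ : α → ℝ}
    (h₀ : Integrable f₀ μ) : ∃ f : α → ℝ, Integrable f μ ∧
      push Φ (μ.withDensityᵥ f₀) = μ.withDensityᵥ f ∧
      ∀ p : ℝ≥0∞, eLpNorm f p μ = eLpNorm f₀ p μ := by
  let f : α → ℝ := Function.extend Φ f₀ 0
  have hcomp : f ∘ Φ = f₀ := Function.extend_comp hΦ.injective f₀ 0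
  have hf : Integrable f μ := by rwa [← hμ.integrable_comp_emb hΦ, hcomp]
  refine ⟨f, hf, VectorMeasure.ext fun s hs => ?_, fun p => ?_⟩
  · rw [push, VectorMeasure.map_apply _ hΦ.measurable hs,
      withDensityᵥ_apply h₀ (hΦ.measurable hs), withDensityᵥ_apply hf hs, ← hcomp]
    exact hμ.setIntegral_preimage_emb hΦ f s
  · rw [← hcomp, eLpNorm_comp_measurePreserving hf.aestronglyMeasurable hμ]

theorem IsSolution.exists_density {k : Plane → Plane} (hk : SmoothBdd k)
    (hdiv : ∀ x, LinearMap.trace ℝ Plane (fderiv ℝ k x) = 0) {f₀ : Plane → ℝ}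
    {θ : ℝ → SignedMeasure Plane} (h₀ : Integrable f₀)
    (h : IsSolution k (volume.withDensityᵥ f₀) θ) {t : ℝ} (ht : 0 ≤ t) :
    ∃ f : Plane → ℝ, Integrable f ∧ θ t = volume.withDensityᵥ f ∧
      ∀ p : ℝ≥0∞, eLpNorm f p volume = eLpNorm f₀ p volume := by
  obtain ⟨u, L, X, hu, hX, hvel, -, hpush⟩ := h.exists_flow hk ht
  have hdiv_u (s : ℝ) (x : Plane) : LinearMap.trace ℝ Plane (fderiv ℝ (u s) x) = 0 := by
    obtain ⟨r, -, hr⟩ := hvel s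
    rw [hr]
    exact trace_fderiv_velocity hk hdiv _ x
  rw [hpush t (right_mem_Icc.2 ht)]
  exact exists_push_withDensity (hX.measurableEmbedding hu t) (hX.measurePreserving hu hdiv_u ht) h₀

end Density

section Existence

section Parametric

variable {F : Type*} [NormedAddCommGroup F] [NormedSpace ℝ F] {B : ℝ}

theorem continuous_sintegral_of_norm_le {τ : Type*} [TopologicalSpace τ]
    [FirstCountableTopology τ] {d : τ → Plane → F}
    (hd : Continuous fun q : τ × Plane => d q.1 q.2) (hB : ∀ t x, ‖d t x‖ ≤ B)
    (μ : SignedMeasure Plane) : Continuous fun t => sintegral μ (d t) :=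
  (continuous_integral_of_norm_le hd hB).sub (continuous_integral_of_norm_le hd hB)

theorem sintegral_intervalIntegral {d : ℝ → Plane → F}
    (hd : Continuous fun q : ℝ × Plane => d q.1 q.2) (hB : ∀ t x, ‖d t x‖ ≤ B)
    (μ : SignedMeasure Plane) (a b : ℝ) :
    sintegral μ (fun x => ∫ s in a..b, d s x) = ∫ s in a..b, sintegral μ (d s) := by
  have hint (ν : Measure Plane) [IsFiniteMeasure ν] :
      IntervalIntegrable (fun s => ∫ x, d s x ∂ν) volume a b :=
    (continuous_integral_of_norm_le hd hB).intervalIntegrable a b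
  simp only [sintegral]
  rw [intervalIntegral.integral_sub (hint _) (hint _),
    intervalIntegral_integral_swap (integrable_uncurry_of_norm_le hd hB a b),
    intervalIntegral_integral_swap (integrable_uncurry_of_norm_le hd hB a b)]

end Parametric

theorem IsFlow.sintegral_comp_sub {u X : ℝ → Plane → Plane} (hX : IsFlow u X)
    (hXc : Continuous fun q : ℝ × Plane => X q.1 q.2)
    (huc : Continuous fun q : ℝ × Plane => u q.1 (X q.1 q.2)) {B : ℝ}
    (huB : ∀ t x, ‖u t (X t x)‖ ≤ B) (μ : SignedMeasure Plane) {φ : Plane → ℝ}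
    (hφ : ContDiff ℝ ∞ φ) (hc : HasCompactSupport φ) (t : ℝ) :
    (Continuous fun s => sintegral μ fun x => fderiv ℝ φ (X s x) (u s (X s x))) ∧
      sintegral μ (fun x => φ (X t x)) - sintegral μ φ
        = ∫ s in (0 : ℝ)..t, sintegral μ fun x => fderiv ℝ φ (X s x) (u s (X s x)) := by
  obtain ⟨A, hA⟩ := exists_norm_fderiv_le hφ hc
  obtain ⟨C, hC⟩ := hc.exists_bound_of_continuous hφ.continuous
  have hd : Continuous fun q : ℝ × Plane => fderiv ℝ φ (X q.1 q.2) (u q.1 (X q.1 q.2)) :=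
    ((hφ.continuous_fderiv (by simp)).comp hXc).clm_apply huc
  have hdB (s : ℝ) (x : Plane) : ‖fderiv ℝ φ (X s x) (u s (X s x))‖ ≤ A * B :=
    (ContinuousLinearMap.le_opNorm _ _).trans
      (mul_le_mul (hA _) (huB s x) (norm_nonneg _) ((norm_nonneg _).trans (hA 0)))
  have hderiv (x : Plane) (s : ℝ) :
      HasDerivAt (fun s => φ (X s x)) (fderiv ℝ φ (X s x) (u s (X s x))) s :=
    (hφ.differentiable (by simp) _).hasFDerivAt.comp_hasDerivAt s (hX.isIntegralCurve x s)
  have hftc (x : Plane) :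
      ∫ s in (0 : ℝ)..t, fderiv ℝ φ (X s x) (u s (X s x)) = φ (X t x) - φ x := by
    rw [intervalIntegral.integral_eq_sub_of_hasDerivAt (fun s _ => hderiv x s)
      ((hd.comp (Continuous.prodMk_left x)).intervalIntegrable _ _), hX.zero]
  have hφX : Integrable (fun x => φ (X t x)) μ.totalVariation :=
    integrable_of_continuous_of_norm_le
      (hφ.continuous.comp (hXc.comp (Continuous.prodMk_right t))) fun x => hC _
  refine ⟨continuous_sintegral_of_norm_le hd hdB μ, ?_⟩
  rw [← sintegral_intervalIntegral hd hdB,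
    ← sintegral_sub hφX (integrable_of_continuous_of_norm_le hφ.continuous hC)]
  simp only [hftc]

variable {k : Plane → Plane} {B : ℝ} {K : ℝ≥0}

/-- The velocity `k ⋆ (Φ_* μ)` of the image of `μ` under `Φ`, with the integral pulled back to `μ`:
in this form it is regular in `Φ`, which need not be injective. -/
def inducedVelocity (k : Plane → Plane) (μ : SignedMeasure Plane) (Φ : Plane → Plane)
    (z : Plane) : Plane :=
  sintegral μ fun y => k (z - Φ y)

theorem velocity_push {Φ : Plane → Plane} (hΦ : MeasurableEmbedding Φ) (k : Plane → Plane)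
    (μ : SignedMeasure Plane) : velocity k (push Φ μ) = inducedVelocity k μ Φ :=
  funext fun _ => sintegral_push hΦ μ _

theorem norm_inducedVelocity_le (hB : ∀ x, ‖k x‖ ≤ B) (μ : SignedMeasure Plane)
    (Φ : Plane → Plane) (z : Plane) :
    ‖inducedVelocity k μ Φ z‖ ≤ B * μ.totalVariation.real univ :=
  norm_sintegral_le (fun _ => hB _) le_rfl

theorem norm_inducedVelocity_sub_le (hB : ∀ x, ‖k x‖ ≤ B) (hK : LipschitzWith K k)
    (μ : SignedMeasure Plane) {Φ Ψ : Plane → Plane} (hΦ : Continuous Φ) (hΨ : Continuous Ψ)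
    {a : ℝ} (ha : ∀ y, ‖Φ y - Ψ y‖ ≤ a) (z w : Plane) :
    ‖inducedVelocity k μ Φ z - inducedVelocity k μ Ψ w‖
      ≤ K * (‖z - w‖ + a) * μ.totalVariation.real univ := by
  have hint {Φ : Plane → Plane} (hΦ : Continuous Φ) (z : Plane) :
      Integrable (fun y => k (z - Φ y)) μ.totalVariation :=
    integrable_of_continuous_of_norm_le (hK.continuous.comp (continuous_const.sub hΦ))
      fun y => hB _
  refine norm_sintegral_sub_le (hint hΦ z) (hint hΨ w) (fun y => ?_) le_rfl
  calc ‖k (z - Φ y) - k (w - Ψ y)‖ ≤ K * ‖(z - Φ y) - (w - Ψ y)‖ := hK.norm_sub_le _ _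
    _ = K * ‖(z - w) - (Φ y - Ψ y)‖ := by rw [sub_sub_sub_comm]
    _ ≤ K * (‖z - w‖ + a) := by
        gcongr
        exact (norm_sub_le _ _).trans (add_le_add_right (ha y) _)

theorem lipschitzWith_inducedVelocity (hB : ∀ x, ‖k x‖ ≤ B) (hK : LipschitzWith K k)
    (μ : SignedMeasure Plane) {Φ : Plane → Plane} (hΦ : Continuous Φ) :
    LipschitzWith (K * (μ.totalVariation univ).toNNReal) (inducedVelocity k μ Φ) :=
  LipschitzWith.of_dist_le_mul fun z w => by
    have hsub := norm_inducedVelocity_sub_le hB hK μ hΦ hΦ (a := 0) (by simp) z w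
    rw [add_zero, mul_right_comm] at hsub
    rwa [dist_eq_norm, dist_eq_norm]

/-- The vector field on the space of displacements `D = Φ - id` whose integral curves are the
trajectories of all particles under the velocity that they induce. -/
def displacementField (hB : ∀ x, ‖k x‖ ≤ B) (hK : LipschitzWith K k) (μ : SignedMeasure Plane)
    (D : Plane →ᵇ Plane) : Plane →ᵇ Plane :=
  BoundedContinuousFunction.ofNormedAddCommGroup
    (fun x => inducedVelocity k μ (fun y => y + D y) (x + D x))
    ((lipschitzWith_inducedVelocity hB hK μ (continuous_id.add D.continuous)).continuous.comp
      (continuous_id.add D.continuous))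
    (B * μ.totalVariation.real univ) fun _ => norm_inducedVelocity_le hB μ _ _

theorem norm_displacementField_le (hB : ∀ x, ‖k x‖ ≤ B) (hK : LipschitzWith K k)
    (μ : SignedMeasure Plane) (D : Plane →ᵇ Plane) :
    ‖displacementField hB hK μ D‖ ≤ B * μ.totalVariation.real univ :=
  BoundedContinuousFunction.norm_ofNormedAddCommGroup_le _
    (mul_nonneg ((norm_nonneg _).trans (hB 0)) measureReal_nonneg) _

theorem lipschitzWith_displacementField (hB : ∀ x, ‖k x‖ ≤ B) (hK : LipschitzWith K k)
    (μ : SignedMeasure Plane) :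
    LipschitzWith (2 * K * (μ.totalVariation univ).toNNReal) (displacementField hB hK μ) := by
  refine LipschitzWith.of_dist_le_mul fun D D' => ?_
  refine (BoundedContinuousFunction.dist_le (by positivity)).2 fun x => ?_
  have hD (y : Plane) : ‖y + D y - (y + D' y)‖ ≤ dist D D' := by
    simpa only [add_sub_add_left_eq_sub, dist_eq_norm] using
      BoundedContinuousFunction.dist_coe_le_dist (f := D) (g := D') y
  calc dist (displacementField hB hK μ D x) (displacementField hB hK μ D' x)
      ≤ K * (‖x + D x - (x + D' x)‖ + dist D D') * μ.totalVariation.real univ := by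
        rw [dist_eq_norm]
        exact norm_inducedVelocity_sub_le hB hK μ (continuous_id.add D.continuous)
          (continuous_id.add D'.continuous) hD _ _
    _ ≤ K * (dist D D' + dist D D') * μ.totalVariation.real univ := by
        gcongr
        exact hD x
    _ = 2 * K * μ.totalVariation.real univ * dist D D' := by ring

theorem exists_isFlow_inducedVelocity (hB : ∀ x, ‖k x‖ ≤ B) (hK : LipschitzWith K k)
    (μ : SignedMeasure Plane) :
    ∃ X : ℝ → Plane → Plane, IsFlow (fun t => inducedVelocity k μ (X t)) X ∧
      Continuous fun q : ℝ × Plane => X q.1 q.2 := by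
  have hB₀ : 0 ≤ B * μ.totalVariation.real univ :=
    mul_nonneg ((norm_nonneg _).trans (hB 0)) measureReal_nonneg
  obtain ⟨D, hD₀, hD⟩ := exists_isIntegralCurve (v := fun _ => displacementField hB hK μ)
    (B := ⟨_, hB₀⟩) (fun _ => norm_displacementField_le hB hK μ)
    (fun _ => lipschitzWith_displacementField hB hK μ) (fun _ => continuous_const) 0
  refine ⟨fun t x => x + D t x, ⟨fun x => by simp [hD₀], fun x t => ?_⟩,
    continuous_snd.add ((hD.continuous.comp continuous_fst).eval continuous_snd)⟩
  exact ((BoundedContinuousFunction.evalCLM ℝ x).hasFDerivAt.comp_hasDerivAt t (hD t)).const_add x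

theorem IsFlow.isSolution (hk : Continuous k) (hB : ∀ x, ‖k x‖ ≤ B) {θ₀ : SignedMeasure Plane}
    {X : ℝ → Plane → Plane} (hX : IsFlow (fun t => velocity k (push (X t) θ₀)) X)
    (hXc : Continuous fun q : ℝ × Plane => X q.1 q.2) (hXe : ∀ t, MeasurableEmbedding (X t)) :
    IsSolution k θ₀ fun t => push (X t) θ₀ := by
  have huc : Continuous fun q : ℝ × Plane => velocity k (push (X q.1) θ₀) (X q.1 q.2) := by
    simp only [velocity_push (hXe _)]
    refine continuous_sintegral_of_norm_le
      (d := fun (q : ℝ × Plane) y => k (X q.1 q.2 - X q.1 y)) ?_ (fun _ _ => hB _) θ₀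
    exact hk.comp ((hXc.comp continuous_fst).sub
      (hXc.comp ((continuous_fst.comp continuous_fst).prodMk continuous_snd)))
  have huB (t : ℝ) (x : Plane) :
      ‖velocity k (push (X t) θ₀) (X t x)‖ ≤ B * θ₀.totalVariation.real univ := by
    rw [velocity_push (hXe t)]
    exact norm_inducedVelocity_le hB θ₀ _ _
  constructor
  · intro T
    refine ⟨(θ₀.totalVariation univ).toNNReal, fun t _ => ?_⟩
    rw [totalVariation_push_univ (hXe t), ENNReal.coe_toNNReal (measure_ne_top _ _)]
  · intro φ hφ hc t _
    simp only [sintegral_push (hXe _)]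
    exact (hX.sintegral_comp_sub hXc huc huB θ₀ hφ hc t).1.intervalIntegrable _ _
  · intro φ hφ hc t _
    simp only [sintegral_push (hXe _)]
    exact (hX.sintegral_comp_sub hXc huc huB θ₀ hφ hc t).2

theorem exists_isSolution (hB : ∀ x, ‖k x‖ ≤ B) (hK : LipschitzWith K k)
    (θ₀ : SignedMeasure Plane) : ∃ θ : ℝ → SignedMeasure Plane, IsSolution k θ₀ θ := by
  obtain ⟨X, hX, hXc⟩ := exists_isFlow_inducedVelocity hB hK θ₀
  have hXt (t : ℝ) : Continuous (X t) := hXc.comp (Continuous.prodMk_right t)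
  have hXe (t : ℝ) : MeasurableEmbedding (X t) :=
    (hXt t).measurableEmbedding
      (hX.injective (fun s => lipschitzWith_inducedVelocity hB hK θ₀ (hXt s)) t)
  simp only [← velocity_push (hXe _)] at hX
  exact ⟨_, hX.isSolution hK.continuous hB hXc hXe⟩

end Existence

end GSQG

end

theorem corollaryc_general :
    ∃ C : ℝ≥0 → ℝ → ℝ≥0 → ℝ≥0, ∀ k : GSQG.Plane → GSQG.Plane, GSQG.SmoothBdd k →
      (∀ θ₀ : SignedMeasure GSQG.Plane, ∃ θ : ℝ → SignedMeasure GSQG.Plane,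
        GSQG.IsSolution k θ₀ θ) ∧
      (∀ (θ₀ : SignedMeasure GSQG.Plane) (θ θ' : ℝ → SignedMeasure GSQG.Plane),
        GSQG.IsSolution k θ₀ θ → GSQG.IsSolution k θ₀ θ' → ∀ t : ℝ, 0 ≤ t → θ t = θ' t) ∧
      GSQG.kernelConst k ≠ ⊤ ∧
      (∀ (θ₀₁ θ₀₂ : SignedMeasure GSQG.Plane) (θ₁ θ₂ : ℝ → SignedMeasure GSQG.Plane)
        (M : ℝ≥0) (T : ℝ), θ₀₁.totalVariation Set.univ ≤ M →
        GSQG.IsSolution k θ₀₁ θ₁ → GSQG.IsSolution k θ₀₂ θ₂ →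
        (⨆ t ∈ Set.Icc 0 T, GSQG.signedWass (θ₁ t) (θ₂ t))
          ≤ C (GSQG.kernelConst k).toNNReal T M * GSQG.signedWass θ₀₁ θ₀₂) ∧
      ((∀ x, LinearMap.trace ℝ GSQG.Plane (fderiv ℝ k x) = 0) →
        ∀ (f₀ : GSQG.Plane → ℝ) (θ : ℝ → SignedMeasure GSQG.Plane), Integrable f₀ →
        GSQG.IsSolution k (volume.withDensityᵥ f₀) θ →
        ∀ t : ℝ, 0 ≤ t → ∃ f : GSQG.Plane → ℝ, Integrable f ∧ θ t = volume.withDensityᵥ f ∧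
          ∀ p : ℝ≥0∞, eLpNorm f p volume = eLpNorm f₀ p volume) := by
  refine ⟨fun c T M => Real.toNNReal (Real.exp (2 * c * M * T)), fun k hk => ?_⟩
  obtain ⟨B, -, hB⟩ := hk.exists_norm_le
  refine ⟨GSQG.exists_isSolution hB (GSQG.lipschitzWith_kernelConst hk),
    fun θ₀ θ θ' h h' t ht => h.unique hk h' ht, GSQG.kernelConst_ne_top hk,
    fun θ₀₁ θ₀₂ θ₁ θ₂ M T hM h₁ h₂ => iSup₂_le fun t ht => ?_,
    fun hdiv f₀ θ h₀ h t ht => h.exists_density hk hdiv h₀ ht⟩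
  exact GSQG.signedWass_le hk h₁ h₂ (ENNReal.toReal_le_of_le_ofReal M.coe_nonneg
    (hM.trans_eq ENNReal.ofReal_coe_nnreal.symm)) ht

theorem corollaryc :
    ∃ C : ℝ≥0 → ℝ → ℝ≥0 → ℝ≥0,
      ∀ (m κ : ℝ) (ρ : GSQG.Plane → ℝ) (ε : ℝ),
        1 < m → m < 2 → GSQG.IsMollifier ρ → 0 < ε →
        -- existence
        (∀ θ₀ : SignedMeasure GSQG.Plane,
          ∃ θ : ℝ → SignedMeasure GSQG.Plane,
            GSQG.IsSolution (GSQG.regKernel m κ ρ ε) θ₀ θ) ∧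
        -- uniqueness
        (∀ (θ₀ : SignedMeasure GSQG.Plane) (θ θ' : ℝ → SignedMeasure GSQG.Plane),
          GSQG.IsSolution (GSQG.regKernel m κ ρ ε) θ₀ θ →
          GSQG.IsSolution (GSQG.regKernel m κ ρ ε) θ₀ θ' →
          ∀ t : ℝ, 0 ≤ t → θ t = θ' t) ∧
        -- stability
        GSQG.kernelConst (GSQG.regKernel m κ ρ ε) ≠ ⊤ ∧
        (∀ (θ₀₁ θ₀₂ : SignedMeasure GSQG.Plane) (θ₁ θ₂ : ℝ → SignedMeasure GSQG.Plane)
          (M : ℝ≥0) (T : ℝ),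
          θ₀₁.toJordanDecomposition.posPart Set.univ
            = θ₀₂.toJordanDecomposition.posPart Set.univ →
          θ₀₁.toJordanDecomposition.negPart Set.univ
            = θ₀₂.toJordanDecomposition.negPart Set.univ →
          θ₀₁.totalVariation Set.univ ≤ M →
          GSQG.IsSolution (GSQG.regKernel m κ ρ ε) θ₀₁ θ₁ →
          GSQG.IsSolution (GSQG.regKernel m κ ρ ε) θ₀₂ θ₂ →
          0 < T →
          (⨆ t ∈ Set.Icc 0 T, GSQG.signedWass (θ₁ t) (θ₂ t))
            ≤ C (GSQG.kernelConst (GSQG.regKernel m κ ρ ε)).toNNReal T M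
              * GSQG.signedWass θ₀₁ θ₀₂) ∧
        -- the bound on the Lebesgue norms
        (∀ (f₀ : GSQG.Plane → ℝ) (θ : ℝ → SignedMeasure GSQG.Plane),
          MemLp f₀ 1 volume → MemLp f₀ ⊤ volume →
          GSQG.IsSolution (GSQG.regKernel m κ ρ ε) (volume.withDensityᵥ f₀) θ →
          ∀ t : ℝ, 0 ≤ t → ∃ f : GSQG.Plane → ℝ,
            MemLp f 1 volume ∧ MemLp f ⊤ volume ∧ θ t = volume.withDensityᵥ f ∧
            ∀ p : ℝ≥0∞, eLpNorm f p volume ≤ eLpNorm f₀ p volume) := by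
  obtain ⟨C, hC⟩ := corollaryc_general
  refine ⟨C, fun m κ ρ ε hm₁ hm hρ hε => ?_⟩
  obtain ⟨hexists, hunique, hconst, hstable, hdensity⟩ :=
    hC _ (GSQG.smoothBdd_regKernel (κ := κ) hm₁ hm hρ hε)
  refine ⟨hexists, hunique, hconst, fun θ₀₁ θ₀₂ θ₁ θ₂ M T _ _ hM h₁ h₂ _ =>
    hstable θ₀₁ θ₀₂ θ₁ θ₂ M T hM h₁ h₂, fun f₀ θ hf₀ hf₀_top h t ht => ?_⟩
  obtain ⟨f, hf, hθ, hnorm⟩ := hdensity (GSQG.trace_fderiv_regKernel hm₁ hm hρ hε) f₀ θ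
    (memLp_one_iff_integrable.1 hf₀) h t ht
  exact ⟨f, memLp_one_iff_integrable.2 hf,
    ⟨hf.aestronglyMeasurable, (hnorm ⊤).trans_lt hf₀_top.eLpNorm_lt_top⟩, hθ,
    fun p => (hnorm p).le⟩
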